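/- **Notation.** $\mathbb{R}^n$ carries the Euclidean norm, products the norm $\|(u,v)\|=\sqrt{\|u\|^2+\|v\|^2}$, matrices the operator norm. For proper $q:\mathbb{R}^m\to\overline{\mathbb{R}}$, $\partial q$ is the limiting (Mordukhovich) subdifferential (empty off $\operatorname{dom} q$). Let $F:\mathbb{R}^m\rightrightarrows\mathbb{R}^m$. The SC derivative $\mathcal{S}F(y,z)$ is the set of all $m$-dimensional subspaces $L\subset\mathbb{R}^m\times\mathbb{R}^m$ for which there are $(y_k,z_k)\in\operatorname{gph}F$, $(y_k,z_k)\to(y,z)$, such that the Bouligand tangent cones $T_k$ to $\operatorname{gph}F$ at $(y_k,z_k)$ are $m$-dimensional subspaces and $T_k\to L$ (in the norm of the orthogonal projections). With $L^*=\{(-v^*,u^*)\mid(u^*,v^*)\in L^\perp\}$, put $\mathcal{S}^*F(y,z)=\{L^*\mid L\in\mathcal{S}F(y,z)\}$. $F$ is *SCD semismooth\** at $(\bar y,\bar z)\in\operatorname{gph}F$ if $\mathcal{S}^*F(y,z)\neq\emptyset$ for all $(y,z)\in\operatorname{gph}F$ close to $(\bar y,\bar z)$, and for every $\varepsilon>0$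 there is $\delta>0$ with $$|\langle y^*,y-\bar y\rangle-\langle z^*,z-\bar z\rangle|\le\varepsilon\,\|(y,z)-(\bar y,\bar z)\|\,\|(z^*,y^*)\|$$ whenever $(y,z)\in\operatorname{gph}F$, $\|(y,z)-(\bar y,\bar z)\|<\delta$, $L^*\in\mathcal{S}^*F(y,z)$ and $(z^*,y^*)\in L^*$. We write $\operatorname{rge}(Z,Y)=\{(Zp,Yp)\mid p\in\mathbb{R}^m\}$. For $\Omega\subset\mathbb{R}^n$ open, a mapping $H:\Omega\to\mathbb{R}^l$ is *semismooth on $\Omega$ with respect to* $\Phi:\mathbb{R}^n\rightrightarrows\mathbb{R}^{l\times n}$ if at every $\bar x\in\Omega$: $\operatorname{dom}\Phi$ is a neighborhood of $\bar x$, $\Phi$ is locally bounded at $\bar x$, and $\sup_{A\in\Phi(x)}\|H(x)-H(\bar x)-A(x-\bar x)\|=o(\|x-\bar x\|)$ as $x\to\bar x$. **Assumptions.** - (SS1) $\varphi(x,y)=\psi(x,y)+q(y)$ with $\psi:\mathbb{R}^n\times\mathbb{R}^m\to\mathbb{R}$ twice continuously differentiable and $q:\mathbb{R}^m\to\overline{\mathbb{R}}$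 proper and lower semicontinuous. - (SS2) $\Omega\subset\mathbb{R}^n$ is open and $\operatorname{arg\,min}_{y\in\mathbb{R}^m}\varphi(x,y)=\{\sigma(x)\}$ for every $x\in\Omega$. - (SS3) Every $\bar x\in\Omega$ has a neighborhood $U$ such that $\{\sigma(x)\mid x\in U\cap\Omega\}$ is bounded. - (SS4) For every $x\in\Omega$, $\partial q$ is SCD semismooth\* at $(\sigma(x),-\nabla_y\psi(x,\sigma(x))^T)$. - (SS5) For every $x\in\Omega$ and all $Z^*,Y^*\in\mathbb{R}^{m\times m}$ with $\operatorname{rge}(Z^*,Y^*)\in\mathcal{S}^*(\partial q)(\sigma(x),-\nabla_y\psi(x,\sigma(x))^T)$, the matrix $\nabla^2_{yy}\psi(x,\sigma(x))Z^*+Y^*$ is nonsingular. **Theorem.** Assume (SS1)–(SS5). Then $\sigma$ is semismooth on $\Omega$ with respect to the mapping $\Psi$ given by $$\Psi(x)=\{-(\nabla^2_{yy}\psi(x,\sigma(x))Z^*+Y^*)^{-T}\,{Z^*}^T\nabla^2_{yx}\psi(x,\sigma(x))\mid \operatorname{rge}(Z^*,Y^*)\in\mathcal{S}^*(\partial q)(\sigma(x),-\nabla_y\psi(x,\sigma(x))^T)\}$$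 for $x\in\Omega$ and $\Psi(x)=\emptyset$ otherwise. Further, the reduced function $\vartheta(x)=\inf_y\varphi(x,y)$ is finite and differentiable on $\Omega$ with $\nabla\vartheta(x)=\nabla_x\psi(x,\sigma(x))$, and $\nabla\vartheta^T$ is semismooth on $\Omega$ with respect to $$\Theta(x)=\{\nabla^2_{xx}\psi(x,\sigma(x))+\nabla^2_{xy}\psi(x,\sigma(x))A\mid A\in\Psi(x)\}\ (x\in\Omega),\qquad \Theta(x)=\emptyset\ (x\notin\Omega).$$ Consequently the semismooth Newton method applies: if $\hat x\in\Omega$ is a global minimizer of $\vartheta$ over $\mathbb{R}^n$ and all matrices $G\in(\operatorname{cl}\Theta)(\hat x)$ are nonsingular, where $\operatorname{gph}(\operatorname{cl}\Theta)$ is the closure of $\operatorname{gph}\Theta$, then there is a neighborhood $U$ of $\hat x$ such that for every starting point $x^{(0)}\in U$ the iteration $x^{(k+1)}=x^{(k)}-{G^{(k)}}^{-1}\nabla\vartheta(x^{(k)})^T$ with arbitrary $G^{(k)}\in\Theta(x^{(k)})$ is well defined (for $x\in U$ the set $\Theta(x)$ is nonempty, its elements are nonsingular, and the iterates stay in $U$)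 and converges superlinearly to $\hat x$. -/

import Mathlib

open Filter Topology Set Asymptotics
open scoped Matrix Matrix.Norms.L2Operator InnerProductSpace

noncomputable section

namespace SCDNewton

/-- `ℝⁿ` with the Euclidean norm. -/
abbrev E (n : ℕ) : Type := EuclideanSpace ℝ (Fin n)

/-- `ℝⁿ × ℝᵐ` with the norm `‖(u, v)‖ = √(‖u‖² + ‖v‖²)`. -/
abbrev EProd (n m : ℕ) : Type := WithLp 2 (E n × E m)

/-- The pair `(u, v)` as an element of `ℝⁿ × ℝᵐ`. -/
abbrev pair {n m : ℕ} (u : E n) (v : E m) : EProd n m := WithLp.toLp 2 (u, v)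

/-- The product `A p` of a matrix and a column vector. -/
abbrev mulV {l k : ℕ} (A : Matrix (Fin l) (Fin k) ℝ) (p : E k) : E l :=
  Matrix.toEuclideanLin A p

/-- The Jacobian of `G : ℝᵏ → ℝˡ` at `x`, as an `l × k` matrix. -/
def jacobian {k l : ℕ} (G : E k → E l) (x : E k) : Matrix (Fin l) (Fin k) ℝ :=
  Matrix.toEuclideanLin.symm (fderiv ℝ G x).toLinearMap

/-! ### Multifunctions, graphs, closures -/

/-- The graph of a multifunction `F : ℝⁿ ⇉ ℝᵐ`. -/
def gph {n m : ℕ} (F : E n → Set (E m)) : Set (EProd n m) :=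
  {p | p.snd ∈ F p.fst}

/-- The multifunction `cl Φ`, whose graph is the closure of the graph of the
matrix-valued multifunction `Φ`. -/
def clMap {n k l : ℕ} (Φ : E n → Set (Matrix (Fin k) (Fin l) ℝ)) (x : E n) :
    Set (Matrix (Fin k) (Fin l) ℝ) :=
  {A | (x, A) ∈ closure {p : E n × Matrix (Fin k) (Fin l) ℝ | p.2 ∈ Φ p.1}}

/-! ### Subdifferentials of extended real-valued functions -/

/-- The regular (Fréchet) subdifferential at a point of the domain:
`liminf (f x - f x₀ - ⟪v, x - x₀⟫) / ‖x - x₀‖ ≥ 0`, written with `ε`; empty off the domain. -/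
def regSubdiff {m : ℕ} (f : E m → EReal) (x₀ : E m) : Set (E m) :=
  {v | f x₀ ≠ ⊤ ∧ ∀ ε : ℝ, 0 < ε → ∀ᶠ x in 𝓝 x₀,
    f x₀ + ((⟪v, x - x₀⟫_ℝ - ε * ‖x - x₀‖ : ℝ) : EReal) ≤ f x}

/-- The limiting (Mordukhovich) subdifferential `∂f`; empty off the domain. -/
def limSubdiff {m : ℕ} (f : E m → EReal) (x₀ : E m) : Set (E m) :=
  {v | f x₀ ≠ ⊤ ∧ ∃ (x : ℕ → E m) (w : ℕ → E m),
    (∀ k, w k ∈ regSubdiff f (x k)) ∧ Tendsto x atTop (𝓝 x₀) ∧ Tendsto w atTop (𝓝 v) ∧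
    Tendsto (fun k => f (x k)) atTop (𝓝 (f x₀))}

/-! ### Subspaces and the SC derivative -/

/-- The (Bouligand, contingent) tangent cone to `A` at `z`. -/
def bouligandCone {n m : ℕ} (A : Set (EProd n m)) (z : EProd n m) : Set (EProd n m) :=
  {u | ∃ (t : ℕ → ℝ) (w : ℕ → EProd n m), (∀ k, 0 < t k) ∧ Tendsto t atTop (𝓝 0) ∧
    Tendsto w atTop (𝓝 u) ∧ ∀ k, z + t k • w k ∈ A}

/-- The distance `‖P₁ - P₂‖` of the orthogonal projections onto two subspaces. -/
def subspaceDist {n m : ℕ} (L₁ L₂ : Submodule ℝ (EProd n m)) : ℝ :=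
  ‖L₁.starProjection - L₂.starProjection‖

/-- The adjoint subspace `L* = {(-v, u) | (u, v) ∈ Lᗮ}`. -/
def adjSubspace {n m : ℕ} (L : Submodule ℝ (EProd n m)) : Submodule ℝ (EProd m n) where
  carrier := {p | pair p.snd (-p.fst) ∈ Lᗮ}
  zero_mem' := by
    have h : pair (0 : EProd m n).snd (-(0 : EProd m n).fst) = (0 : EProd n m) := by
      apply WithLp.ofLp_injective 2; ext <;> simp
    simp only [mem_ofPred_eq, h, Submodule.zero_mem]
  add_mem' := by
    intro a b ha hb
    have h : pair (a + b).snd (-(a + b).fst) = pair a.snd (-a.fst) + pair b.snd (-b.fst) := by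
      apply WithLp.ofLp_injective 2; ext <;> simp [add_comm]
    simp only [mem_ofPred_eq, h]
    exact Submodule.add_mem _ ha hb
  smul_mem' := by
    intro c a ha
    have h : pair (c • a).snd (-(c • a).fst) = c • pair a.snd (-a.fst) := by
      apply WithLp.ofLp_injective 2; ext <;> simp
    simp only [mem_ofPred_eq, h]
    exact Submodule.smul_mem _ _ ha

/-- The subspace `rge (A, B) = {(A p, B p) | p ∈ ℝᵏ}`. -/
def rge {n m k : ℕ} (A : Matrix (Fin n) (Fin k) ℝ) (B : Matrix (Fin m) (Fin k) ℝ) :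
    Submodule ℝ (EProd n m) :=
  LinearMap.range ((WithLp.linearEquiv 2 ℝ (E n × E m)).symm.toLinearMap ∘ₗ
    (Matrix.toEuclideanLin A).prod (Matrix.toEuclideanLin B))

/-- The SC derivative `𝒮F(z)`: all `n`-dimensional subspaces `L` that are limits of
tangent cones `T` to `gph F`, which are themselves `n`-dimensional subspaces, taken at points
`z k ∈ gph F` tending to `z`. -/
def SC {n m : ℕ} (F : E n → Set (E m)) (z : EProd n m) : Set (Submodule ℝ (EProd n m)) :=
  {L | Module.finrank ℝ L = n ∧
    ∃ (zs : ℕ → EProd n m) (T : ℕ → Submodule ℝ (EProd n m)),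
      (∀ k, zs k ∈ gph F) ∧
      (∀ k, (T k : Set (EProd n m)) = bouligandCone (gph F) (zs k)) ∧
      (∀ k, Module.finrank ℝ (T k) = n) ∧
      Tendsto zs atTop (𝓝 z) ∧
      Tendsto (fun k => subspaceDist L (T k)) atTop (𝓝 0)}

/-- The adjoint SC derivative `𝒮*F(z) = {L* | L ∈ 𝒮F(z)}`. -/
def SCadj {n m : ℕ} (F : E n → Set (E m)) (z : EProd n m) : Set (Submodule ℝ (EProd m n)) :=
  adjSubspace '' SC F z

/-- `F` is SCD semismooth* at the point `(x₀, y₀)` of its graph. -/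
def SCDSemismoothStarAt {n m : ℕ} (F : E n → Set (E m)) (x₀ : E n) (y₀ : E m) : Prop :=
  pair x₀ y₀ ∈ gph F ∧
  (∀ᶠ z in 𝓝 (pair x₀ y₀), z ∈ gph F → (SCadj F z).Nonempty) ∧
  ∀ ε : ℝ, 0 < ε → ∃ δ : ℝ, 0 < δ ∧
    ∀ (x : E n) (y : E m), y ∈ F x → ‖pair x y - pair x₀ y₀‖ < δ →
      ∀ L ∈ SCadj F (pair x y), ∀ (yd : E m) (xd : E n), pair yd xd ∈ L →
        |⟪xd, x - x₀⟫_ℝ - ⟪yd, y - y₀⟫_ℝ| ≤ ε * ‖pair x y - pair x₀ y₀‖ * ‖pair yd xd‖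

/-! ### Semismoothness with respect to a multifunction -/

/-- `F : Ω → ℝᵐ` is semismooth with respect to `Ψ` at `x₀`: the domain of `Ψ` is a neighborhood
of `x₀`, `Ψ` is locally bounded at `x₀`, and
`sup {‖F x - F x₀ - A (x - x₀)‖ | A ∈ Ψ x} = o(‖x - x₀‖)` as `x → x₀` in `Ω`. -/
def SemismoothAt {n m : ℕ} (Ω : Set (E n)) (F : E n → E m)
    (Ψ : E n → Set (Matrix (Fin m) (Fin n) ℝ)) (x₀ : E n) : Prop :=
  {x | (Ψ x).Nonempty} ∈ 𝓝 x₀ ∧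
  (∃ M : ℝ, ∀ᶠ x in 𝓝 x₀, ∀ A ∈ Ψ x, ‖A‖ ≤ M) ∧
  ∀ ε : ℝ, 0 < ε → ∀ᶠ x in 𝓝[Ω] x₀, ∀ A ∈ Ψ x,
    ‖F x - F x₀ - mulV A (x - x₀)‖ ≤ ε * ‖x - x₀‖

/-- `F` is semismooth on `Ω` with respect to `Ψ`. -/
def SemismoothOn {n m : ℕ} (Ω : Set (E n)) (F : E n → E m)
    (Ψ : E n → Set (Matrix (Fin m) (Fin n) ℝ)) : Prop :=
  ∀ x ∈ Ω, SemismoothAt Ω F Ψ x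

/-! ### The decomposable problem -/

/-- The objective `φ(x, y) = ψ(x, y) + q(y)`. -/
def objective {n m : ℕ} (ψ : E n → E m → ℝ) (q : E m → EReal) (x : E n) (y : E m) : EReal :=
  (ψ x y : EReal) + q y

/-- The reduced objective `ϑ(x) = inf_y φ(x, y)`. -/
def reduced {n m : ℕ} (ψ : E n → E m → ℝ) (q : E m → EReal) (x : E n) : EReal :=
  ⨅ y, objective ψ q x y

/-- `ϑ` as a real-valued function (meaningful where `ϑ` is finite). -/
def reducedReal {n m : ℕ} (ψ : E n → E m → ℝ) (q : E m → EReal) (x : E n) : ℝ :=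
  (reduced ψ q x).toReal

/-- The partial gradient `∇ₓψ(x, y)`, as a column vector. -/
def gradX {n m : ℕ} (ψ : E n → E m → ℝ) (x : E n) (y : E m) : E n :=
  gradient (fun x' => ψ x' y) x

/-- The partial gradient `∇_yψ(x, y)`, as a column vector. -/
def gradY {n m : ℕ} (ψ : E n → E m → ℝ) (x : E n) (y : E m) : E m :=
  gradient (fun y' => ψ x y') y

/-- `∇²ₓₓψ(x, y)`: the Jacobian in `x` of `∇ₓψ`. -/
def hessXX {n m : ℕ} (ψ : E n → E m → ℝ) (x : E n) (y : E m) : Matrix (Fin n) (Fin n) ℝ :=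
  jacobian (fun x' => gradX ψ x' y) x

/-- `∇²_{xy}ψ(x, y)`: the Jacobian in `y` of `∇ₓψ`. -/
def hessXY {n m : ℕ} (ψ : E n → E m → ℝ) (x : E n) (y : E m) : Matrix (Fin n) (Fin m) ℝ :=
  jacobian (fun y' => gradX ψ x y') y

/-- `∇²_{yx}ψ(x, y)`: the Jacobian in `x` of `∇_yψ`. -/
def hessYX {n m : ℕ} (ψ : E n → E m → ℝ) (x : E n) (y : E m) : Matrix (Fin m) (Fin n) ℝ :=
  jacobian (fun x' => gradY ψ x' y) x

/-- `∇²_{yy}ψ(x, y)`: the Jacobian in `y` of `∇_yψ`. -/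
def hessYY {n m : ℕ} (ψ : E n → E m → ℝ) (x : E n) (y : E m) : Matrix (Fin m) (Fin m) ℝ :=
  jacobian (fun y' => gradY ψ x y') y

/-- `Ψ(x) = {-(∇²_{yy}ψ Z + Y)⁻ᵀ (Zᵀ ∇²_{yx}ψ) | rge (Z, Y) ∈ 𝒮*(∂q)(σ(x), -∇_yψ)}` for
`x ∈ Ω`, with the derivatives of `ψ` taken at `(x, σ(x))`, and `Ψ(x) = ∅` for `x ∉ Ω`. -/
def PsiMap {n m : ℕ} (ψ : E n → E m → ℝ) (q : E m → EReal) (Ω : Set (E n)) (σ : E n → E m)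
    (x : E n) : Set (Matrix (Fin m) (Fin n) ℝ) :=
  {A | x ∈ Ω ∧ ∃ Z Y : Matrix (Fin m) (Fin m) ℝ,
    rge Z Y ∈ SCadj (limSubdiff q) (pair (σ x) (-gradY ψ x (σ x))) ∧
    A = -(((hessYY ψ x (σ x) * Z + Y)⁻¹)ᵀ * (Zᵀ * hessYX ψ x (σ x)))}

/-- `Θ(x) = {∇²ₓₓψ + ∇²_{xy}ψ A | A ∈ Ψ(x)}` for `x ∈ Ω`, with the derivatives of `ψ` taken at
`(x, σ(x))`, and `Θ(x) = ∅` for `x ∉ Ω`. -/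
def ThetaMap {n m : ℕ} (ψ : E n → E m → ℝ) (q : E m → EReal) (Ω : Set (E n)) (σ : E n → E m)
    (x : E n) : Set (Matrix (Fin n) (Fin n) ℝ) :=
  {G | x ∈ Ω ∧ ∃ A ∈ PsiMap ψ q Ω σ x, G = hessXX ψ x (σ x) + hessXY ψ x (σ x) * A}

/-- One semismooth Newton step `x - G⁻¹ g(x)` for the equation `g = 0`. -/
def newtonStep {n : ℕ} (g : E n → E n) (G : Matrix (Fin n) (Fin n) ℝ) (x : E n) : E n :=
  x - mulV G⁻¹ (g x)

/-- The semismooth Newton method for `g = 0` with matrices from `Θ` is locally well defined and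
superlinearly convergent at `x₀`: there is a neighborhood `U` of `x₀` such that at every point
of `U` a step can be made, every matrix offered by `Θ` is nonsingular, the step stays in `U`,
and every sequence of iterates that starts in `U` converges superlinearly to `x₀`. -/
def NewtonSuperlinearAt {n : ℕ} (g : E n → E n) (Θ : E n → Set (Matrix (Fin n) (Fin n) ℝ))
    (x₀ : E n) : Prop :=
  ∃ U ∈ 𝓝 x₀,
    (∀ x ∈ U, (Θ x).Nonempty ∧ ∀ G ∈ Θ x, IsUnit G.det ∧ newtonStep g G x ∈ U) ∧
    ∀ (x : ℕ → E n) (G : ℕ → Matrix (Fin n) (Fin n) ℝ), x 0 ∈ U →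
      (∀ k, G k ∈ Θ (x k) ∧ x (k + 1) = newtonStep g (G k) (x k)) →
      Tendsto x atTop (𝓝 x₀) ∧
      (fun k => ‖x (k + 1) - x₀‖) =o[atTop] (fun k => ‖x k - x₀‖)

end SCDNewton

end

open SCDNewton

/-! Fix `x₀` in `Ω`. Write `dx = x - x₀`, `dy = σ x - σ x₀`, let `dz` be the increment of `-∇_yψ(x,
σ(x))`, and let `B`, `H` be the blocks `∇²_{yx}ψ`, `∇²_{yy}ψ` at `(x, σ x)`. For `A ∈ Ψ(x)` the
error to be bounded is `w = dy - A dx`. The idea is to test `w` against itself. With `C = H Z + Y`,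
the pair `(z*, y*) = (Z C⁻¹ w, Y C⁻¹ w)` lies in `rge (Z, Y)` and satisfies `H z* + y* = w` and `⟪A
dx, w⟫ = -⟪B dx, z*⟫`. By symmetry of `H`, `‖w‖² = (⟪y*, dy⟫ - ⟪z*, dz⟫) + ⟪z*, dz + B dx + H dy⟫`.
The first bracket is small because `∂q` is SCD semismooth*, the second term because `∇_yψ` is `C¹`.
Both are `o(‖dx‖ + ‖dy‖) ‖(z*, y*)‖`.

Two uniform estimates finish the argument. First, `‖(z*, y*)‖ ≤ κ ‖w‖` near `x₀`: the
`m`-dimensional subspaces form a compact set and `𝒮` has closed graph, so regularity at `x₀` alone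
gives a bound valid nearby (`exists_eventually_norm_le_of_SCadj`). Second, the same test bounds
`‖A‖`, so `dy = O(‖dx‖)`.

Continuity of `σ` follows from local boundedness, lower semicontinuity and uniqueness of the
minimizer. Danskin's argument then gives `∇ϑ(x) = ∇ₓψ(x, σ(x))`, a chain rule makes it semismooth,
and the Newton statement is the standard local analysis. -/

noncomputable section

namespace SCDNewton

/-! ### Compactness of the set of subspaces of a given dimension -/

section Subspaces

variable {V : Type*} [NormedAddCommGroup V] [InnerProductSpace ℝ V]

/-- The map `x ↦ ∑ i, ⟪v i, x⟫ v i`: for orthonormal `v`, the projection onto its span. -/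
def projFamily {k : ℕ} (v : Fin k → V) : V →L[ℝ] V :=
  ∑ i, InnerProductSpace.rankOne ℝ (v i) (v i)

lemma continuous_projFamily {k : ℕ} : Continuous (projFamily : (Fin k → V) → V →L[ℝ] V) := by
  unfold projFamily
  refine continuous_finsetSum _ fun i _ => ?_
  exact ((InnerProductSpace.rankOne ℝ).continuous.comp (continuous_apply i)).clm_apply
    (continuous_apply i)

variable [FiniteDimensional ℝ V]

lemma starProjection_span_eq_projFamily {k : ℕ} {v : Fin k → V} (hv : Orthonormal ℝ v) :
    (Submodule.span ℝ (range v)).starProjection = projFamily v := by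
  ext x
  refine Submodule.eq_starProjection_of_mem_of_inner_eq_zero ?_ ?_
  · simp only [projFamily, _root_.sum_apply, InnerProductSpace.rankOne_apply]
    exact Submodule.sum_mem _ fun i _ =>
      Submodule.smul_mem _ _ (Submodule.subset_span (mem_range_self i))
  · intro w hw
    induction hw using Submodule.span_induction with
    | mem w hw =>
      obtain ⟨j, rfl⟩ := hw
      rw [real_inner_comm]
      simp [projFamily, inner_sub_right, inner_sum, real_inner_smul_right,
        orthonormal_iff_ite.1 hv]
    | zero => simp
    | add a b _ _ ha hb => rw [inner_add_right, ha, hb, add_zero]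
    | smul c a _ ha => rw [inner_smul_right, ha, mul_zero]

lemma exists_orthonormal_span_eq {k : ℕ} (L : Submodule ℝ V) (hL : Module.finrank ℝ L = k) :
    ∃ v : Fin k → V, Orthonormal ℝ v ∧ Submodule.span ℝ (range v) = L := by
  subst hL
  let b := stdOrthonormalBasis ℝ L
  refine ⟨fun i => (b i : V), b.orthonormal.comp_linearIsometry L.subtypeₗᵢ, ?_⟩
  have h : range (fun i => (b i : V)) = L.subtype '' range b := by
    rw [← range_comp]; rfl
  rw [h, Submodule.span_image]
  have := b.toBasis.span_eq
  rw [OrthonormalBasis.coe_toBasis] at this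
  rw [this, Submodule.map_top, Submodule.range_subtype]

lemma isCompact_setOf_orthonormal (k : ℕ) : IsCompact {v : Fin k → V | Orthonormal ℝ v} := by
  refine Metric.isCompact_of_isClosed_isBounded ?_ ?_
  · simp only [orthonormal_iff_ite, ofPred_forall]
    exact isClosed_iInter fun i => isClosed_iInter fun j =>
      isClosed_eq (by fun_prop) continuous_const
  · refine (Metric.isBounded_closedBall (x := (0 : Fin k → V)) (r := 1)).subset fun v hv => ?_
    rw [mem_closedBall_zero_iff, pi_norm_le_iff_of_nonneg zero_le_one]
    exact fun i => (hv.1 i).le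

/-- Sequential compactness of the set of `k`-dimensional subspaces. -/
lemma exists_subseq_tendsto_subspace {k : ℕ} (L : ℕ → Submodule ℝ V)
    (hL : ∀ i, Module.finrank ℝ (L i) = k) :
    ∃ (K : Submodule ℝ V) (s : ℕ → ℕ), Module.finrank ℝ K = k ∧ StrictMono s ∧
      Tendsto (fun i => (L (s i)).starProjection) atTop (𝓝 K.starProjection) := by
  -- Orthonormal frames form a compact set and the projection depends continuously on the frame, so
  -- it suffices to extract a convergent subsequence of frames.
  choose v hv hvL using fun i => exists_orthonormal_span_eq (L i) (hL i)
  obtain ⟨w, hw, s, hs, hsw⟩ := (isCompact_setOf_orthonormal (V := V) k).tendsto_subseq hv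
  refine ⟨Submodule.span ℝ (range w), s, ?_, hs, ?_⟩
  · simpa using finrank_span_eq_card (Orthonormal.linearIndependent hw)
  · rw [starProjection_span_eq_projFamily hw]
    have h := (continuous_projFamily.tendsto w).comp hsw
    refine h.congr fun i => ?_
    rw [← hvL, starProjection_span_eq_projFamily (hv _)]; rfl

lemma mem_orthogonal_of_tendsto {L : ℕ → Submodule ℝ V} {K : Submodule ℝ V} {p : ℕ → V} {p₀ : V}
    (hL : Tendsto (fun i => (L i).starProjection) atTop (𝓝 K.starProjection))
    (hp : Tendsto p atTop (𝓝 p₀)) (hmem : ∀ i, p i ∈ (L i)ᗮ) : p₀ ∈ Kᗮ := by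
  rw [← Submodule.starProjection_apply_eq_zero_iff]
  have hc : Continuous fun v : (V →L[ℝ] V) × V => v.1 v.2 := by fun_prop
  have h := (hc.tendsto (K.starProjection, p₀)).comp (hL.prodMk_nhds hp)
  refine tendsto_nhds_unique h (tendsto_const_nhds.congr fun i => ?_)
  exact ((Submodule.starProjection_apply_eq_zero_iff _).2 (hmem i)).symm

end Subspaces

/-! ### Adjoint subspaces and the SC derivative -/

/-- The linear equivalence `(a, b) ↦ (b, -a)`. -/
def swapNeg (m : ℕ) : EProd m m ≃ₗ[ℝ] EProd m m where
  toFun p := pair p.snd (-p.fst)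
  invFun p := pair (-p.snd) p.fst
  map_add' a b := by apply WithLp.ofLp_injective 2; ext <;> simp [add_comm]
  map_smul' c a := by apply WithLp.ofLp_injective 2; ext <;> simp
  left_inv a := by apply WithLp.ofLp_injective 2; ext <;> simp
  right_inv a := by apply WithLp.ofLp_injective 2; ext <;> simp

lemma finrank_EProd (m : ℕ) : Module.finrank ℝ (EProd m m) = m + m := by
  rw [(WithLp.linearEquiv 2 ℝ (E m × E m)).finrank_eq]
  simp

/-- `L*` is the image of `Lᗮ` under a linear isomorphism, and `Lᗮ` has dimension `2m - m`. -/
lemma finrank_adjSubspace {m : ℕ} {L : Submodule ℝ (EProd m m)} (hL : Module.finrank ℝ L = m) :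
    Module.finrank ℝ (adjSubspace L) = m := by
  have h : adjSubspace L = Lᗮ.map ((swapNeg m).symm : EProd m m →ₗ[ℝ] EProd m m) := by
    rw [← Submodule.comap_equiv_eq_map_symm]; rfl
  rw [h, LinearEquiv.finrank_map_eq]
  have := Submodule.finrank_add_finrank_orthogonal L
  rw [finrank_EProd] at this
  omega

/-- Every `m`-dimensional subspace of `ℝᵐ × ℝᵐ` is of the form `rge (Z, Y)`. -/
lemma exists_rge_eq {m : ℕ} {K : Submodule ℝ (EProd m m)} (hK : Module.finrank ℝ K = m) :
    ∃ Z Y : Matrix (Fin m) (Fin m) ℝ, rge Z Y = K := by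
  let e : E m ≃ₗ[ℝ] K := LinearEquiv.ofFinrankEq _ _ (by rw [hK]; simp)
  let f : E m →ₗ[ℝ] E m × E m :=
    (WithLp.linearEquiv 2 ℝ (E m × E m)).toLinearMap ∘ₗ K.subtype ∘ₗ e.toLinearMap
  refine ⟨Matrix.toEuclideanLin.symm (LinearMap.fst ℝ _ _ ∘ₗ f),
    Matrix.toEuclideanLin.symm (LinearMap.snd ℝ _ _ ∘ₗ f), ?_⟩
  have hf : (WithLp.linearEquiv 2 ℝ (E m × E m)).symm.toLinearMap ∘ₗ f =
      K.subtype ∘ₗ e.toLinearMap := by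
    ext1 x; rfl
  rw [rge, LinearEquiv.apply_symm_apply, LinearEquiv.apply_symm_apply]
  have hp : (LinearMap.fst ℝ (E m) (E m) ∘ₗ f).prod (LinearMap.snd ℝ (E m) (E m) ∘ₗ f) = f := by
    ext1 x; rfl
  rw [hp, hf, LinearMap.range_comp, LinearEquiv.range, Submodule.map_top, Submodule.range_subtype]

/-- Regularity and `Ψ` are phrased with matrix pairs, compactness with subspaces; this allows
passing from the latter to the former. -/
lemma exists_rge_of_mem_SCadj {m : ℕ} {F : E m → Set (E m)} {z : EProd m m}
    {K : Submodule ℝ (EProd m m)} (hK : K ∈ SCadj F z) :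
    ∃ Z Y : Matrix (Fin m) (Fin m) ℝ, rge Z Y = K := by
  obtain ⟨L, hL, rfl⟩ := hK
  exact exists_rge_eq (finrank_adjSubspace hL.1)

lemma subspaceDist_triangle {n m : ℕ} (L₁ L₂ L₃ : Submodule ℝ (EProd n m)) :
    subspaceDist L₁ L₃ ≤ subspaceDist L₁ L₂ + subspaceDist L₂ L₃ :=
  norm_sub_le_norm_sub_add_norm_sub _ _ _

/-- The SC derivative has a closed graph. -/
lemma mem_SC_of_tendsto {n m : ℕ} {F : E n → Set (E m)} {z : EProd n m} {zs : ℕ → EProd n m}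
    {K : Submodule ℝ (EProd n m)} {L : ℕ → Submodule ℝ (EProd n m)}
    (hL : ∀ k, L k ∈ SC F (zs k)) (hz : Tendsto zs atTop (𝓝 z)) (hK : Module.finrank ℝ K = n)
    (hLK : Tendsto (fun k => (L k).starProjection) atTop (𝓝 K.starProjection)) :
    K ∈ SC F z := by
  -- Diagonal argument: for each `k`, one tangent space within `1/(k+1)` of `L k`, at a graph point
  -- within `1/(k+1)` of `zs k`.
  have key : ∀ k : ℕ, ∃ (y : EProd n m) (T : Submodule ℝ (EProd n m)), y ∈ gph F ∧
      (T : Set (EProd n m)) = bouligandCone (gph F) y ∧ Module.finrank ℝ T = n ∧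
      dist y (zs k) < 1 / ((k : ℝ) + 1) ∧ subspaceDist (L k) T < 1 / ((k : ℝ) + 1) := by
    intro k
    obtain ⟨-, ys, T, h1, h2, h3, h4, h5⟩ := hL k
    have hpos : (0 : ℝ) < 1 / ((k : ℝ) + 1) := Nat.one_div_pos_of_nat
    obtain ⟨i, hi, hi'⟩ := ((Metric.tendsto_nhds.1 h4 _ hpos).and
      (h5.eventually_lt_const hpos)).exists
    exact ⟨ys i, T i, h1 i, h2 i, h3 i, hi, hi'⟩
  choose ys T h1 h2 h3 h4 h5 using key
  have h0 : Tendsto (fun k : ℕ => 1 / ((k : ℝ) + 1)) atTop (𝓝 0) :=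
    tendsto_one_div_add_atTop_nhds_zero_nat
  refine ⟨hK, ys, T, h1, h2, h3, ?_, ?_⟩
  · refine (tendsto_iff_of_dist (squeeze_zero (fun _ => dist_nonneg) (fun k => (h4 k).le) h0)).2 hz
  · have hd : Tendsto (fun k => subspaceDist K (L k)) atTop (𝓝 0) := by
      have := (tendsto_iff_norm_sub_tendsto_zero.1 hLK)
      refine this.congr fun k => ?_
      rw [norm_sub_rev]; rfl
    refine squeeze_zero (fun _ => norm_nonneg _)
      (fun k => (subspaceDist_triangle K (L k) (T k)).trans (add_le_add le_rfl (h5 k).le)) ?_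
    simpa using hd.add h0

/-- If all adjoint derivatives at `z₀` meet the kernel of `(a, b) ↦ H₀ a + b` trivially, then
`(a, b) ↦ H a + b` is uniformly bounded below on the adjoint derivatives near `z₀`, for `H` near
`H₀`. -/
lemma exists_eventually_norm_le_of_SCadj {m : ℕ} {F : E m → Set (E m)} {z₀ : EProd m m}
    {H₀ : E m →L[ℝ] E m}
    (h : ∀ K ∈ SCadj F z₀, ∀ p ∈ K, H₀ p.fst + p.snd = 0 → p = 0) :
    ∃ κ : ℝ, 0 < κ ∧ ∀ᶠ w : EProd m m × (E m →L[ℝ] E m) in 𝓝 (z₀, H₀),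
      ∀ K ∈ SCadj F w.1, ∀ p ∈ K, ‖p‖ ≤ κ * ‖w.2 p.fst + p.snd‖ := by
  by_contra hcon
  push Not at hcon
  -- If no `κ` works, unit vectors in adjoint subspaces near `z₀` have images tending to zero. A
  -- limit subspace belongs to `𝒮F(z₀)` by closedness of the graph, and a limit vector is a unit
  -- vector of its adjoint in the kernel.
  have key : ∀ k : ℕ, ∃ (w : EProd m m × (E m →L[ℝ] E m)) (L : Submodule ℝ (EProd m m))
      (p : EProd m m), dist w (z₀, H₀) < 1 / ((k : ℝ) + 1) ∧ L ∈ SC F w.1 ∧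
      p ∈ adjSubspace L ∧ ‖p‖ = 1 ∧ ‖w.2 p.fst + p.snd‖ ≤ 1 / ((k : ℝ) + 1) := by
    intro k
    have hk : (0 : ℝ) < (k : ℝ) + 1 := by positivity
    obtain ⟨w, ⟨_, ⟨L, hL, rfl⟩, p, hp, hlt⟩, hw⟩ := ((hcon ((k : ℝ) + 1) hk).and_eventually
      (Metric.ball_mem_nhds (z₀, H₀) (one_div_pos.2 hk))).exists
    have hp0 : 0 < ‖p‖ := lt_of_le_of_lt (by positivity) hlt
    refine ⟨w, L, ‖p‖⁻¹ • p, hw, hL, Submodule.smul_mem _ _ hp, ?_, ?_⟩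
    · rw [norm_smul, norm_inv, norm_norm, inv_mul_cancel₀ hp0.ne']
    · rw [WithLp.smul_fst, WithLp.smul_snd, map_smul, ← smul_add, norm_smul, norm_inv, norm_norm,
        inv_mul_le_iff₀ hp0, mul_one_div, le_div_iff₀ hk, mul_comm]
      exact hlt.le
  choose w L p hw hL hp hp1 hle using key
  have h0 : Tendsto (fun k : ℕ => 1 / ((k : ℝ) + 1)) atTop (𝓝 0) :=
    tendsto_one_div_add_atTop_nhds_zero_nat
  have hwlim : Tendsto w atTop (𝓝 (z₀, H₀)) :=
    tendsto_iff_dist_tendsto_zero.2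
      (squeeze_zero (fun _ => dist_nonneg) (fun k => (hw k).le) h0)
  obtain ⟨K, s, hK, hs, hsK⟩ := exists_subseq_tendsto_subspace L fun k => (hL k).1
  obtain ⟨p₀, hp₀, r, hr, hrp⟩ := (isCompact_sphere (0 : EProd m m) 1).tendsto_subseq
    (x := p ∘ s) (fun k => by simp [hp1])
  have hsr : Tendsto (s ∘ r) atTop atTop := hs.tendsto_atTop.comp hr.tendsto_atTop
  have hKmem : K ∈ SC F z₀ :=
    mem_SC_of_tendsto (L := fun k => L (s k)) (zs := fun k => (w (s k)).1) (fun k => hL _)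
      ((continuous_fst.tendsto _).comp (hwlim.comp hs.tendsto_atTop)) hK hsK
  have hcj : Continuous fun p : EProd m m => pair p.snd (-p.fst) := by fun_prop
  have hpK : p₀ ∈ adjSubspace K := by
    change pair p₀.snd (-p₀.fst) ∈ Kᗮ
    exact mem_orthogonal_of_tendsto (hsK.comp hr.tendsto_atTop) ((hcj.tendsto p₀).comp hrp)
      fun k => hp (s (r k))
  have hcs : Continuous fun v : (E m →L[ℝ] E m) × EProd m m => v.1 v.2.fst + v.2.snd := by
    fun_prop
  have hz : H₀ p₀.fst + p₀.snd = 0 := by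
    rw [← norm_eq_zero]
    have h1 : Tendsto (fun k => ‖(w (s (r k))).2 (p (s (r k))).fst + (p (s (r k))).snd‖) atTop
        (𝓝 ‖H₀ p₀.fst + p₀.snd‖) :=
      ((hcs.tendsto (H₀, p₀)).comp
        (((continuous_snd.tendsto _).comp (hwlim.comp hsr)).prodMk_nhds hrp)).norm
    exact tendsto_nhds_unique h1
      (squeeze_zero (fun _ => norm_nonneg _) (fun k => hle _) (h0.comp hsr))
  have := h _ ⟨K, hKmem, rfl⟩ p₀ hpK hz
  simp [this] at hp₀

/-! ### Matrices acting on Euclidean vectors -/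

lemma mulV_jacobian {k l : ℕ} (G : E k → E l) (x v : E k) :
    mulV (jacobian G x) v = fderiv ℝ G x v := by
  simp [mulV, jacobian]

lemma mulV_mul {k l r : ℕ} (A : Matrix (Fin k) (Fin l) ℝ) (B : Matrix (Fin l) (Fin r) ℝ)
    (v : E r) : mulV (A * B) v = mulV A (mulV B v) := by
  simp [mulV, Matrix.toLpLin_apply, Matrix.mulVec_mulVec]

lemma mulV_add_left {k l : ℕ} (A B : Matrix (Fin k) (Fin l) ℝ) (v : E l) :
    mulV (A + B) v = mulV A v + mulV B v := by
  simp [mulV]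

lemma mulV_neg_left {k l : ℕ} (A : Matrix (Fin k) (Fin l) ℝ) (v : E l) :
    mulV (-A) v = -mulV A v := by
  simp [mulV]

lemma mulV_one {k : ℕ} (v : E k) : mulV (1 : Matrix (Fin k) (Fin k) ℝ) v = v := by
  simp [mulV]

lemma inner_mulV_transpose {k l : ℕ} (A : Matrix (Fin k) (Fin l) ℝ) (u : E k) (v : E l) :
    ⟪mulV Aᵀ u, v⟫_ℝ = ⟪u, mulV A v⟫_ℝ := by
  rw [← Matrix.conjTranspose_eq_transpose_of_trivial, mulV,
    Matrix.toEuclideanLin_conjTranspose_eq_adjoint, LinearMap.adjoint_inner_left]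

lemma norm_mulV_le {k l : ℕ} (A : Matrix (Fin k) (Fin l) ℝ) (v : E l) :
    ‖mulV A v‖ ≤ ‖A‖ * ‖v‖ :=
  Matrix.l2_opNorm_mulVec A v

lemma norm_le_of_mulV_le {k l : ℕ} {A : Matrix (Fin k) (Fin l) ℝ} {M : ℝ} (hM : 0 ≤ M)
    (h : ∀ v, ‖mulV A v‖ ≤ M * ‖v‖) : ‖A‖ ≤ M := by
  rw [Matrix.l2_opNorm_def]
  exact ContinuousLinearMap.opNorm_le_bound _ hM h

/-- `mulV A` as a continuous linear map. -/
def mulCLM {k l : ℕ} : Matrix (Fin k) (Fin l) ℝ ≃ₗ[ℝ] (E l →L[ℝ] E k) :=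
  Matrix.toEuclideanLin ≪≫ₗ LinearMap.toContinuousLinearMap

lemma mulCLM_apply {k l : ℕ} (A : Matrix (Fin k) (Fin l) ℝ) (v : E l) :
    mulCLM A v = mulV A v := rfl

lemma continuous_mulCLM {k l : ℕ} :
    Continuous (mulCLM : Matrix (Fin k) (Fin l) ℝ → (E l →L[ℝ] E k)) :=
  (mulCLM (k := k) (l := l)).toLinearMap.continuous_of_finiteDimensional

lemma continuous_mulCLM_symm {k l : ℕ} :
    Continuous (mulCLM.symm : (E l →L[ℝ] E k) → Matrix (Fin k) (Fin l) ℝ) :=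
  (mulCLM (k := k) (l := l)).symm.toLinearMap.continuous_of_finiteDimensional

lemma jacobian_eq_mulCLM_symm {k l : ℕ} (G : E k → E l) (x : E k) :
    jacobian G x = mulCLM.symm (fderiv ℝ G x) := rfl

lemma mem_rge {n m k : ℕ} {A : Matrix (Fin n) (Fin k) ℝ} {B : Matrix (Fin m) (Fin k) ℝ}
    {p : EProd n m} : p ∈ rge A B ↔ ∃ v, pair (mulV A v) (mulV B v) = p := Iff.rfl

lemma mulV_inv_cancel {k : ℕ} {A : Matrix (Fin k) (Fin k) ℝ} (hA : IsUnit A.det) (v : E k) :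
    mulV A (mulV A⁻¹ v) = v := by
  rw [← mulV_mul, Matrix.mul_nonsing_inv _ hA, mulV_one]

lemma mulV_inv_cancel' {k : ℕ} {A : Matrix (Fin k) (Fin k) ℝ} (hA : IsUnit A.det) (v : E k) :
    mulV A⁻¹ (mulV A v) = v := by
  rw [← mulV_mul, Matrix.nonsing_inv_mul _ hA, mulV_one]

/-- Nonsingularity in a basis-free form: the compactness argument produces limits of subspaces, not
of the matrices that parametrize them. -/
lemma eq_zero_of_mem_rge {m : ℕ} {H Z Y : Matrix (Fin m) (Fin m) ℝ}
    (hC : IsUnit (H * Z + Y).det) {p : EProd m m} (hp : p ∈ rge Z Y)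
    (h : mulV H p.fst + p.snd = 0) : p = 0 := by
  obtain ⟨v, rfl⟩ := mem_rge.1 hp
  have hv : mulV (H * Z + Y) v = 0 := by rw [mulV_add_left, mulV_mul]; exact h
  have hv0 : v = 0 := by rw [← mulV_inv_cancel' hC v, hv]; exact map_zero _
  subst hv0
  apply WithLp.ofLp_injective 2; ext <;> simp [mulV]

/-- The action of `-(H Z + Y)⁻ᵀ Zᵀ B`, tested against a vector `w`. -/
lemma exists_mem_rge_inner_mulV {n m : ℕ} {H Z Y : Matrix (Fin m) (Fin m) ℝ}
    (B : Matrix (Fin m) (Fin n) ℝ) (hC : IsUnit (H * Z + Y).det) (w : E m) :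
    ∃ p ∈ rge Z Y, mulV H p.fst + p.snd = w ∧
      ∀ d, ⟪mulV (-(((H * Z + Y)⁻¹)ᵀ * (Zᵀ * B))) d, w⟫_ℝ = -⟪mulV B d, p.fst⟫_ℝ := by
  -- The parameter is `(H Z + Y)⁻¹ w`; moving both transposes across the inner product leaves `B d`
  -- paired with `Z (H Z + Y)⁻¹ w`.
  refine ⟨_, mem_rge.2 ⟨mulV (H * Z + Y)⁻¹ w, rfl⟩, ?_, fun d => ?_⟩
  · change mulV H (mulV Z _) + mulV Y _ = w
    rw [← mulV_mul, ← mulV_add_left, mulV_inv_cancel hC]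
  · rw [mulV_neg_left, inner_neg_left, mulV_mul, mulV_mul, inner_mulV_transpose,
      inner_mulV_transpose]
    rfl

/-! ### First-order expansions with partial Jacobians -/

section Partial

variable {n m k : ℕ} {g : E n → E m → E k}

lemma jacobian_fst_apply (hg : ContDiff ℝ 1 fun p : E n × E m => g p.1 p.2) (x : E n) (y : E m) :
    jacobian (fun x' => g x' y) x = mulCLM.symm
      ((fderiv ℝ (fun p : E n × E m => g p.1 p.2) (x, y)).comp (.inl ℝ (E n) (E m))) := by
  rw [jacobian_eq_mulCLM_symm]
  congr 1
  exact (((hg.differentiable one_ne_zero).differentiableAt (x := (x, y))).hasFDerivAt.comp (f := (·, y)) x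
    (hasFDerivAt_prodMk_left x y)).fderiv

lemma jacobian_snd_apply (hg : ContDiff ℝ 1 fun p : E n × E m => g p.1 p.2) (x : E n) (y : E m) :
    jacobian (fun y' => g x y') y = mulCLM.symm
      ((fderiv ℝ (fun p : E n × E m => g p.1 p.2) (x, y)).comp (.inr ℝ (E n) (E m))) := by
  rw [jacobian_eq_mulCLM_symm]
  congr 1
  exact (((hg.differentiable one_ne_zero).differentiableAt (x := (x, y))).hasFDerivAt.comp y
    (hasFDerivAt_prodMk_right x y)).fderiv

lemma continuous_jacobian_fst (hg : ContDiff ℝ 1 fun p : E n × E m => g p.1 p.2) :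
    Continuous fun p : E n × E m => jacobian (fun x' => g x' p.2) p.1 := by
  simp only [jacobian_fst_apply hg]
  exact continuous_mulCLM_symm.comp
    ((hg.continuous_fderiv one_ne_zero).clm_comp continuous_const)

lemma continuous_jacobian_snd (hg : ContDiff ℝ 1 fun p : E n × E m => g p.1 p.2) :
    Continuous fun p : E n × E m => jacobian (fun y' => g p.1 y') p.2 := by
  simp only [jacobian_snd_apply hg]
  exact continuous_mulCLM_symm.comp
    ((hg.continuous_fderiv one_ne_zero).clm_comp continuous_const)

/-- The first-order expansion of a `C¹` map, with the derivative at the moving point. -/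
lemma eventually_norm_sub_jacobian_le (hg : ContDiff ℝ 1 fun p : E n × E m => g p.1 p.2)
    (x₀ : E n) (y₀ : E m) {ε : ℝ} (hε : 0 < ε) :
    ∀ᶠ p : E n × E m in 𝓝 (x₀, y₀), ‖g p.1 p.2 - g x₀ y₀ -
      (mulV (jacobian (fun x' => g x' p.2) p.1) (p.1 - x₀) +
        mulV (jacobian (fun y' => g p.1 y') p.2) (p.2 - y₀))‖
      ≤ ε * (‖p.1 - x₀‖ + ‖p.2 - y₀‖) := by
  set G : E n × E m → E k := fun p => g p.1 p.2
  have h1 := ((hg.differentiable one_ne_zero).differentiableAt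
    (x := (x₀, y₀))).hasFDerivAt.isLittleO.bound (half_pos hε)
  -- Continuity of the derivative moves its base point from the centre to `p`, at the cost of the
  -- other `ε / 2`.
  have h2 : ∀ᶠ p in 𝓝 (x₀, y₀), ‖fderiv ℝ G p - fderiv ℝ G (x₀, y₀)‖ < ε / 2 := by
    have := ((hg.continuous_fderiv one_ne_zero).tendsto (x₀, y₀))
    exact (tendsto_iff_norm_sub_tendsto_zero.1 this).eventually_lt_const (half_pos hε)
  filter_upwards [h1, h2] with p hp1 hp2
  have hn : ‖p - (x₀, y₀)‖ ≤ ‖p.1 - x₀‖ + ‖p.2 - y₀‖ := by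
    rw [Prod.norm_def]
    exact max_le (le_add_of_nonneg_right (norm_nonneg _)) (le_add_of_nonneg_left (norm_nonneg _))
  have hj : mulV (jacobian (fun x' => g x' p.2) p.1) (p.1 - x₀) +
      mulV (jacobian (fun y' => g p.1 y') p.2) (p.2 - y₀) = fderiv ℝ G p (p - (x₀, y₀)) := by
    rw [jacobian_fst_apply hg, jacobian_snd_apply hg, ← mulCLM_apply, ← mulCLM_apply,
      LinearEquiv.apply_symm_apply, LinearEquiv.apply_symm_apply, ContinuousLinearMap.comp_apply,
      ContinuousLinearMap.comp_apply, ← map_add]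
    simp [G, Prod.sub_def]
  rw [hj]
  have h3 : ‖(fderiv ℝ G p - fderiv ℝ G (x₀, y₀)) (p - (x₀, y₀))‖ ≤
      ε / 2 * ‖p - (x₀, y₀)‖ := ContinuousLinearMap.le_of_opNorm_le _ hp2.le _
  calc ‖G p - G (x₀, y₀) - fderiv ℝ G p (p - (x₀, y₀))‖
      = ‖(G p - G (x₀, y₀) - fderiv ℝ G (x₀, y₀) (p - (x₀, y₀))) -
          (fderiv ℝ G p - fderiv ℝ G (x₀, y₀)) (p - (x₀, y₀))‖ := by
        congr 1; simp only [sub_apply]; abel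
    _ ≤ ε / 2 * ‖p - (x₀, y₀)‖ + ε / 2 * ‖p - (x₀, y₀)‖ :=
        (norm_sub_le _ _).trans (add_le_add hp1 h3)
    _ = ε * ‖p - (x₀, y₀)‖ := by ring
    _ ≤ _ := by gcongr

end Partial

/-! ### Partial gradients of a `C²` function -/

section Gradients

variable {n m : ℕ} {ψ : E n → E m → ℝ}

lemma inner_gradient {k : ℕ} (f : E k → ℝ) (x v : E k) : ⟪gradient f x, v⟫_ℝ = fderiv ℝ f x v := by
  rw [gradient, InnerProductSpace.toDual_symm_apply]

lemma gradient_apply {k : ℕ} (f : E k → ℝ) (x : E k) (i : Fin k) :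
    gradient f x i = fderiv ℝ f x (EuclideanSpace.single i 1) := by
  rw [← inner_gradient, EuclideanSpace.inner_single_right]
  simp

lemma fderiv_fst_apply (hψ : ContDiff ℝ 2 fun p : E n × E m => ψ p.1 p.2) (x : E n) (y : E m) :
    fderiv ℝ (fun x' => ψ x' y) x =
      (fderiv ℝ (fun p : E n × E m => ψ p.1 p.2) (x, y)).comp (.inl ℝ (E n) (E m)) :=
  (((hψ.differentiable two_ne_zero).differentiableAt (x := (x, y))).hasFDerivAt.comp (f := (·, y)) x
    (hasFDerivAt_prodMk_left x y)).fderiv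

lemma fderiv_snd_apply (hψ : ContDiff ℝ 2 fun p : E n × E m => ψ p.1 p.2) (x : E n) (y : E m) :
    fderiv ℝ (fun y' => ψ x y') y =
      (fderiv ℝ (fun p : E n × E m => ψ p.1 p.2) (x, y)).comp (.inr ℝ (E n) (E m)) :=
  (((hψ.differentiable two_ne_zero).differentiableAt (x := (x, y))).hasFDerivAt.comp y
    (hasFDerivAt_prodMk_right x y)).fderiv

lemma contDiff_gradX (hψ : ContDiff ℝ 2 fun p : E n × E m => ψ p.1 p.2) :
    ContDiff ℝ 1 fun p : E n × E m => gradX ψ p.1 p.2 := by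
  have h : ContDiff ℝ 1 (fderiv ℝ fun p : E n × E m => ψ p.1 p.2) :=
    hψ.fderiv_right (by norm_num)
  rw [contDiff_euclidean]
  intro i
  simp only [gradX, gradient_apply, fderiv_fst_apply hψ]
  exact (h.clm_comp contDiff_const).clm_apply contDiff_const

lemma contDiff_gradY (hψ : ContDiff ℝ 2 fun p : E n × E m => ψ p.1 p.2) :
    ContDiff ℝ 1 fun p : E n × E m => gradY ψ p.1 p.2 := by
  have h : ContDiff ℝ 1 (fderiv ℝ fun p : E n × E m => ψ p.1 p.2) :=
    hψ.fderiv_right (by norm_num)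
  rw [contDiff_euclidean]
  intro i
  simp only [gradY, gradient_apply, fderiv_snd_apply hψ]
  exact (h.clm_comp contDiff_const).clm_apply contDiff_const

/-- Symmetry of the second derivative. It is needed because `H` acts on `z*` in the test vector but
on `dy` in the expansion of `∇_yψ`. -/
lemma inner_hessYY_comm (hψ : ContDiff ℝ 2 fun p : E n × E m => ψ p.1 p.2) (x : E n) (y : E m)
    (u v : E m) : ⟪mulV (hessYY ψ x y) u, v⟫_ℝ = ⟪u, mulV (hessYY ψ x y) v⟫_ℝ := by
  have hx : ContDiff ℝ 2 (ψ x) := hψ.comp (contDiff_prodMk_right x)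
  have hg : Differentiable ℝ (fun y' => gradY ψ x y') :=
    ((contDiff_gradY hψ).comp (contDiff_prodMk_right x)).differentiable one_ne_zero
  have hd : Differentiable ℝ (fderiv ℝ (ψ x)) :=
    (hx.fderiv_right (m := 1) (by norm_num)).differentiable one_ne_zero
  have key : ∀ a b : E m, ⟪mulV (hessYY ψ x y) a, b⟫_ℝ = fderiv ℝ (fderiv ℝ (ψ x)) y a b := by
    intro a b
    rw [hessYY, mulV_jacobian]
    have h1 : HasFDerivAt (fun y' => ⟪gradY ψ x y', b⟫_ℝ)
        ((innerSL ℝ b).comp (fderiv ℝ (fun y' => gradY ψ x y') y)) y := by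
      simp only [real_inner_comm b]
      exact (innerSL ℝ b).hasFDerivAt.comp y (hg y).hasFDerivAt
    have h2 : HasFDerivAt (fun y' => fderiv ℝ (ψ x) y' b)
        ((ContinuousLinearMap.apply ℝ ℝ b).comp (fderiv ℝ (fderiv ℝ (ψ x)) y)) y :=
      (ContinuousLinearMap.apply ℝ ℝ b).hasFDerivAt.comp y (hd y).hasFDerivAt
    have h3 : (fun y' => ⟪gradY ψ x y', b⟫_ℝ) = fun y' => fderiv ℝ (ψ x) y' b := by
      funext y'; exact inner_gradient _ _ _
    rw [h3] at h1
    have := congrArg (fun f : E m →L[ℝ] ℝ => f a) (h1.unique h2)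
    simpa [real_inner_comm] using this
  rw [key, real_inner_comm, key]
  exact (hx.contDiffAt.isSymmSndFDerivAt (by simp)) u v

end Gradients

section Reduced

variable {n m : ℕ} {ψ : E n → E m → ℝ} {q : E m → EReal} {Ω : Set (E n)} {σ : E n → E m}

/-! ### The solution map and the reduced function -/

lemma objective_le_iff {x : E n} {y y' : E m} (hy : q y ≠ ⊤) (hyb : q y ≠ ⊥) (hy' : q y' ≠ ⊤)
    (hyb' : q y' ≠ ⊥) : objective ψ q x y ≤ objective ψ q x y' ↔
      ψ x y + (q y).toReal ≤ ψ x y' + (q y').toReal := by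
  rw [objective, objective, ← EReal.coe_toReal hy hyb, ← EReal.coe_toReal hy' hyb',
    EReal.toReal_coe, EReal.toReal_coe, ← EReal.coe_add, ← EReal.coe_add, EReal.coe_le_coe_iff]

lemma ne_top_of_isMin (hq_dom : ∃ y, q y ≠ ⊤) {x : E n} {y : E m}
    (hy : ∀ y', objective ψ q x y ≤ objective ψ q x y') : q y ≠ ⊤ := by
  intro h
  obtain ⟨y', hy'⟩ := hq_dom
  have := hy y'
  rw [objective, h, EReal.coe_add_top, top_le_iff] at this
  exact (EReal.add_ne_top (EReal.coe_ne_top _) hy') this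

/-- Near `x₀` the values stay in a compact set, so it is enough that every cluster point minimizes
`φ(x₀, ·)`; uniqueness then identifies it with `σ x₀`. -/
lemma continuousAt_argmin (hψ : Continuous fun p : E n × E m => ψ p.1 p.2)
    (hq_lsc : LowerSemicontinuous q) (hq_bot : ∀ y, q y ≠ ⊥) (hq_dom : ∃ y, q y ≠ ⊤)
    (hΩ : IsOpen Ω) (hσ : ∀ x ∈ Ω, {y | ∀ y', objective ψ q x y ≤ objective ψ q x y'} = {σ x})
    {x₀ : E n} (hx₀ : x₀ ∈ Ω) (hbdd : ∃ U ∈ 𝓝 x₀, Bornology.IsBounded (σ '' (U ∩ Ω))) :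
    ContinuousAt σ x₀ := by
  obtain ⟨U, hU, hb⟩ := hbdd
  have hmin : ∀ x ∈ Ω, ∀ y', objective ψ q x (σ x) ≤ objective ψ q x y' := fun x hx => by
    have : σ x ∈ {y | ∀ y', objective ψ q x y ≤ objective ψ q x y'} := by rw [hσ x hx]; rfl
    exact this
  refine hb.isCompact_closure.tendsto_nhds_of_unique_mapClusterPt (l := 𝓝 x₀) ?_ ?_
  · filter_upwards [hU, hΩ.mem_nhds hx₀] with x hx hx'
    exact subset_closure ⟨x, ⟨hx, hx'⟩, rfl⟩
  · intro y _ hy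
    obtain ⟨F, hF, hFy⟩ := mapClusterPt_iff_ultrafilter.1 hy
    have hFx : Tendsto (fun x : E n => x) F (𝓝 x₀) := hF
    have hmem : y ∈ {y | ∀ y', objective ψ q x₀ y ≤ objective ψ q x₀ y'} := by
      intro y'
      by_cases hy' : q y' = ⊤
      · rw [objective, objective, hy', EReal.coe_add_top]; exact le_top
      have hle : q y ≤ ((ψ x₀ y' + (q y').toReal - ψ x₀ y : ℝ) : EReal) := by
        -- Otherwise some real `c` separates the two sides. Along the ultrafilter lower
        -- semicontinuity gives `q (σ x) > c`, while comparing `σ x` with `y'` gives `q (σ x) < c`.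
        by_contra! hlt
        obtain ⟨c, hc1, hc2⟩ := EReal.lt_iff_exists_real_btwn.1 hlt
        have h1 : ∀ᶠ x in (F : Filter (E n)), (c : EReal) < q (σ x) :=
          hFy.eventually (hq_lsc y _ hc2)
        have h2 : Tendsto (fun x => ψ x y' + (q y').toReal - ψ x (σ x)) F
            (𝓝 (ψ x₀ y' + (q y').toReal - ψ x₀ y)) :=
          ((((hψ.tendsto (x₀, y')).comp (hFx.prodMk_nhds tendsto_const_nhds)).add_const _).sub
            ((hψ.tendsto (x₀, y)).comp (hFx.prodMk_nhds hFy)))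
        have h3 := h2.eventually_lt_const (EReal.coe_lt_coe_iff.1 hc1)
        have h4 : ∀ᶠ x in (F : Filter (E n)), x ∈ Ω := hF (hΩ.mem_nhds hx₀)
        obtain ⟨x, hx1, hx3, hx4⟩ := (h1.and (h3.and h4)).exists
        have ht := ne_top_of_isMin hq_dom (hmin x hx4)
        have := (objective_le_iff ht (hq_bot _) hy' (hq_bot _)).1 (hmin x hx4 y')
        rw [← EReal.coe_toReal ht (hq_bot _), EReal.coe_lt_coe_iff] at hx1
        linarith
      have ht : q y ≠ ⊤ := ne_top_of_le_ne_top (EReal.coe_ne_top _) hle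
      rw [objective_le_iff ht (hq_bot _) hy' (hq_bot _)]
      rw [← EReal.coe_toReal ht (hq_bot _), EReal.coe_le_coe_iff] at hle
      linarith
    rw [hσ x₀ hx₀] at hmem
    exact hmem

lemma reduced_eq_coe (hq_bot : ∀ y, q y ≠ ⊥) {x : E n} {y : E m} (hy : q y ≠ ⊤)
    (hmin : ∀ y', objective ψ q x y ≤ objective ψ q x y') :
    reduced ψ q x = ((ψ x y + (q y).toReal : ℝ) : EReal) := by
  have h : reduced ψ q x = objective ψ q x y := le_antisymm (iInf_le _ _) (le_iInf hmin)
  rw [h, objective, EReal.coe_add, EReal.coe_toReal hy (hq_bot _)]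

/-- Danskin's formula for the gradient of the reduced function. -/
lemma hasGradientAt_reducedReal (hψ : ContDiff ℝ 2 fun p : E n × E m => ψ p.1 p.2)
    (hq_bot : ∀ y, q y ≠ ⊥) (hq_dom : ∃ y, q y ≠ ⊤) (hΩ : IsOpen Ω)
    (hmin : ∀ x ∈ Ω, ∀ y', objective ψ q x (σ x) ≤ objective ψ q x y')
    {x₀ : E n} (hx₀ : x₀ ∈ Ω) (hσ : ContinuousAt σ x₀) :
    HasGradientAt (reducedReal ψ q) (gradX ψ x₀ (σ x₀)) x₀ := by
  rw [hasGradientAt_iff_isLittleO, isLittleO_iff]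
  intro ε hε
  have htop : ∀ x ∈ Ω, q (σ x) ≠ ⊤ := fun x hx => ne_top_of_isMin hq_dom (hmin x hx)
  have hval : ∀ x ∈ Ω, reducedReal ψ q x = ψ x (σ x) + (q (σ x)).toReal := fun x hx => by
    rw [reducedReal, reduced_eq_coe hq_bot (htop x hx) (hmin x hx), EReal.toReal_coe]
  have hle : ∀ x ∈ Ω, ∀ x' ∈ Ω, ψ x (σ x) + (q (σ x)).toReal ≤ ψ x (σ x') + (q (σ x')).toReal :=
    fun x hx x' hx' => (objective_le_iff (htop x hx) (hq_bot _) (htop x' hx') (hq_bot _)).1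
      (hmin x hx _)
  -- Strict differentiability is what permits the second argument to move with `x` while only the
  -- first is incremented.
  have hs := (hψ.contDiffAt (x := (x₀, σ x₀)).hasStrictFDerivAt two_ne_zero).isLittleO.bound hε
  have hpair : ∀ᶠ p : E n × E m in 𝓝 (x₀, σ x₀),
      |ψ p.1 p.2 - ψ x₀ p.2 - ⟪gradX ψ x₀ (σ x₀), p.1 - x₀⟫_ℝ| ≤ ε * ‖p.1 - x₀‖ := by
    have hc : Tendsto (fun p : E n × E m => (p, (x₀, p.2))) (𝓝 (x₀, σ x₀))
        (𝓝 ((x₀, σ x₀), (x₀, σ x₀))) := by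
      have : Continuous fun p : E n × E m => (p, (x₀, p.2)) := by fun_prop
      exact this.tendsto (x₀, σ x₀)
    filter_upwards [hc.eventually hs] with p hp
    rw [gradX, inner_gradient, fderiv_fst_apply hψ, ← Real.norm_eq_abs]
    simpa [Prod.norm_def, Prod.sub_def] using hp
  have hxx : ∀ᶠ x in 𝓝 x₀, |ψ x (σ x₀) - ψ x₀ (σ x₀) - ⟪gradX ψ x₀ (σ x₀), x - x₀⟫_ℝ| ≤
      ε * ‖x - x₀‖ :=
    (continuousAt_id.prodMk continuousAt_const : ContinuousAt (fun x => (x, σ x₀)) x₀).eventually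
      hpair
  have hxσ : ∀ᶠ x in 𝓝 x₀, |ψ x (σ x) - ψ x₀ (σ x) - ⟪gradX ψ x₀ (σ x₀), x - x₀⟫_ℝ| ≤
      ε * ‖x - x₀‖ :=
    (continuousAt_id.prodMk hσ : ContinuousAt (fun x => (x, σ x)) x₀).eventually hpair
  filter_upwards [hxx, hxσ, hΩ.mem_nhds hx₀] with x h1 h2 hx
  rw [hval x hx, hval x₀ hx₀, Real.norm_eq_abs]
  -- Comparing each minimizer at the other parameter squeezes `ϑ(x) - ϑ(x₀)` between `ψ(x, σ x) -
  -- ψ(x₀, σ x)` and `ψ(x, σ x₀) - ψ(x₀, σ x₀)`.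
  have h3 := hle x hx x₀ hx₀
  have h4 := hle x₀ hx₀ x hx
  rw [abs_le] at h1 h2 ⊢
  constructor <;> linarith [h1.1, h1.2, h2.1, h2.2]

/-! ### Semismoothness of the solution map -/

/-- The core computation, used with `e = A dx`, `c = B dx` and `p = (z*, y*)`: expand `‖w‖²`, bound
both parts by `‖p‖ ≤ κ ‖w‖`, and cancel one factor `‖w‖`. -/
lemma norm_le_of_semismoothStar_bound {H : Matrix (Fin m) (Fin m) ℝ}
    (hH : ∀ u v, ⟪mulV H u, v⟫_ℝ = ⟪u, mulV H v⟫_ℝ) {p : EProd m m} {e dy dz c w : E m}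
    {κ ε₁ ε₂ : ℝ} (hw : w = dy - e) (he : ⟪e, w⟫_ℝ = -⟪c, p.fst⟫_ℝ)
    (hp : mulV H p.fst + p.snd = w) (hpn : ‖p‖ ≤ κ * ‖w‖) (hε₁ : 0 ≤ ε₁) (hκ : 0 ≤ κ)
    (h₁ : |⟪p.snd, dy⟫_ℝ - ⟪p.fst, dz⟫_ℝ| ≤ ε₁ * ‖p‖) (h₂ : ‖-dz - (c + mulV H dy)‖ ≤ ε₂) :
    ‖w‖ ≤ κ * (ε₁ + ε₂) := by
  have hε₂ : 0 ≤ ε₂ := (norm_nonneg _).trans h₂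
  have hfst : ‖p.fst‖ ≤ ‖p‖ := WithLp.norm_fst_le _ _
  have h3 : ‖w‖ * ‖w‖ = (⟪p.snd, dy⟫_ℝ - ⟪p.fst, dz⟫_ℝ) - ⟪p.fst, -dz - (c + mulV H dy)⟫_ℝ := by
    have h4 : ⟪dy, w⟫_ℝ = ⟪p.fst, mulV H dy⟫_ℝ + ⟪p.snd, dy⟫_ℝ := by
      conv_lhs => rw [← hp]
      rw [inner_add_right, ← hH, real_inner_comm, real_inner_comm p.snd]
    rw [← real_inner_self_eq_norm_mul_norm]
    conv_lhs => rw [hw, inner_sub_left, ← hw, he, h4]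
    rw [inner_sub_right, inner_add_right, inner_neg_right, real_inner_comm c]
    ring
  have h5 : |⟪p.fst, -dz - (c + mulV H dy)⟫_ℝ| ≤ ‖p‖ * ε₂ :=
    (abs_real_inner_le_norm _ _).trans (mul_le_mul hfst h₂ (norm_nonneg _) (norm_nonneg _))
  have h6 : ‖w‖ * ‖w‖ ≤ ‖w‖ * (κ * (ε₁ + ε₂)) := by
    have : ‖p‖ * (ε₁ + ε₂) ≤ κ * ‖w‖ * (ε₁ + ε₂) := by gcongr
    nlinarith [(abs_le.1 h₁).2, (abs_le.1 h5).1]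
  rcases (norm_nonneg w).eq_or_lt with h0 | h0
  · rw [← h0]; positivity
  · exact le_of_mul_le_mul_left h6 h0

lemma tendsto_comp_graph {W : Type*} [TopologicalSpace W] {J : E n → E m → W}
    (hJ : Continuous fun p : E n × E m => J p.1 p.2) {x₀ : E n} (hσ : ContinuousAt σ x₀) :
    Tendsto (fun x => J x (σ x)) (𝓝 x₀) (𝓝 (J x₀ (σ x₀))) :=
  (hJ.tendsto (x₀, σ x₀)).comp
    (continuousAt_id.prodMk hσ : ContinuousAt (fun x => (x, σ x)) x₀)

lemma continuous_hessYY (hψ : ContDiff ℝ 2 fun p : E n × E m => ψ p.1 p.2) :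
    Continuous fun p : E n × E m => hessYY ψ p.1 p.2 := by
  unfold hessYY
  exact continuous_jacobian_snd (contDiff_gradY hψ)

/-- The point of the graph of `∂q` at which the derivatives of the solution map are formed. -/
abbrev graphPoint (ψ : E n → E m → ℝ) (σ : E n → E m) (x : E n) : EProd m m :=
  pair (σ x) (-gradY ψ x (σ x))

lemma continuousAt_graphPoint (hψ : ContDiff ℝ 2 fun p : E n × E m => ψ p.1 p.2) {x₀ : E n}
    (hσ : ContinuousAt σ x₀) : ContinuousAt (graphPoint ψ σ) x₀ := by
  have h : Continuous fun p : E n × E m => pair p.2 (-gradY ψ p.1 p.2) := by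
    have := (contDiff_gradY hψ).continuous
    fun_prop
  exact (h.tendsto (x₀, σ x₀)).comp
    (continuousAt_id.prodMk hσ : ContinuousAt (fun x => (x, σ x)) x₀)

/-- Near a regular point, every element `A` of `Ψ x` can be tested against a vector `w` through
an element of the adjoint derivative whose norm is controlled by that of `w`. -/
lemma eventually_PsiMap_test (hψ : ContDiff ℝ 2 fun p : E n × E m => ψ p.1 p.2)
    (hreg : ∀ x ∈ Ω, ∀ Z Y : Matrix (Fin m) (Fin m) ℝ,
      rge Z Y ∈ SCadj (limSubdiff q) (graphPoint ψ σ x) →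
        IsUnit (hessYY ψ x (σ x) * Z + Y).det)
    {x₀ : E n} (hx₀ : x₀ ∈ Ω) (hσ : ContinuousAt σ x₀) :
    ∃ κ : ℝ, 0 < κ ∧ ∀ᶠ x in 𝓝 x₀, ∀ A ∈ PsiMap ψ q Ω σ x, ∀ w : E m,
      ∃ K ∈ SCadj (limSubdiff q) (graphPoint ψ σ x), ∃ p ∈ K,
        mulV (hessYY ψ x (σ x)) p.fst + p.snd = w ∧ ‖p‖ ≤ κ * ‖w‖ ∧
        ∀ d, ⟪mulV A d, w⟫_ℝ = -⟪mulV (hessYX ψ x (σ x)) d, p.fst⟫_ℝ := by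
  have hker : ∀ K ∈ SCadj (limSubdiff q) (graphPoint ψ σ x₀), ∀ p ∈ K,
      mulCLM (hessYY ψ x₀ (σ x₀)) p.fst + p.snd = 0 → p = 0 := by
    intro K hK p hp h
    obtain ⟨Z, Y, rfl⟩ := exists_rge_of_mem_SCadj hK
    exact eq_zero_of_mem_rge (hreg x₀ hx₀ Z Y hK) hp h
  obtain ⟨κ, hκ, hev⟩ := exists_eventually_norm_le_of_SCadj hker
  refine ⟨κ, hκ, ?_⟩
  have hH : Tendsto (fun x => mulCLM (hessYY ψ x (σ x))) (𝓝 x₀)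
      (𝓝 (mulCLM (hessYY ψ x₀ (σ x₀)))) :=
    (continuous_mulCLM.tendsto _).comp (tendsto_comp_graph (continuous_hessYY hψ) hσ)
  have hg : Tendsto (graphPoint ψ σ) (𝓝 x₀) (𝓝 (graphPoint ψ σ x₀)) :=
    continuousAt_graphPoint hψ hσ
  filter_upwards [(hg.prodMk_nhds hH).eventually hev] with x hx
  rintro A ⟨hxΩ, Z, Y, hK, rfl⟩ w
  obtain ⟨p, hp, hpw, hd⟩ :=
    exists_mem_rge_inner_mulV (hessYX ψ x (σ x)) (hreg x hxΩ Z Y hK) w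
  refine ⟨_, hK, p, hp, hpw, ?_, hd⟩
  have := hx _ hK p hp
  rwa [mulCLM_apply, hpw] at this

lemma eventually_norm_le_of_continuous {k l : ℕ} {J : E n × E m → Matrix (Fin k) (Fin l) ℝ}
    (hJ : Continuous J) {x₀ : E n} (hσ : ContinuousAt σ x₀) :
    ∀ᶠ x in 𝓝 x₀, ‖J (x, σ x)‖ ≤ ‖J (x₀, σ x₀)‖ + 1 :=
  ((((hJ.tendsto (x₀, σ x₀)).comp (continuousAt_id.prodMk hσ :
    ContinuousAt (fun x => (x, σ x)) x₀)).norm).eventually_lt_const (lt_add_one _)).mono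
      fun _ h => h.le

lemma semismoothAt_argmin (hψ : ContDiff ℝ 2 fun p : E n × E m => ψ p.1 p.2)
    (hΩ : IsOpen Ω)
    (hSCD : ∀ x ∈ Ω, SCDSemismoothStarAt (limSubdiff q) (σ x) (-gradY ψ x (σ x)))
    (hreg : ∀ x ∈ Ω, ∀ Z Y : Matrix (Fin m) (Fin m) ℝ,
      rge Z Y ∈ SCadj (limSubdiff q) (graphPoint ψ σ x) →
        IsUnit (hessYY ψ x (σ x) * Z + Y).det)
    {x₀ : E n} (hx₀ : x₀ ∈ Ω) (hσ : ContinuousAt σ x₀) :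
    SemismoothAt Ω σ (PsiMap ψ q Ω σ) x₀ := by
  obtain ⟨κ, hκ, htest⟩ := eventually_PsiMap_test hψ hreg hx₀ hσ
  obtain ⟨-, hne, hss⟩ := hSCD x₀ hx₀
  have hgp := continuousAt_graphPoint hψ hσ
  have hΩx := hΩ.mem_nhds hx₀
  have hB := eventually_norm_le_of_continuous (continuous_jacobian_fst (contDiff_gradY hψ)) hσ
  have hH := eventually_norm_le_of_continuous (continuous_jacobian_snd (contDiff_gradY hψ)) hσ
  set MB := ‖jacobian (fun x' => gradY ψ x' (σ x₀)) x₀‖ + 1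
  set MH := ‖jacobian (fun y' => gradY ψ x₀ y') (σ x₀)‖ + 1
  have hMB : 0 ≤ MB := by positivity
  have hMH : 0 ≤ MH := by positivity
  -- Testing `A d` against itself bounds `Ψ` without any bound on `Z`, `Y` or the inverse.
  have hAd : ∀ᶠ x in 𝓝 x₀, ∀ A ∈ PsiMap ψ q Ω σ x, ∀ d, ‖mulV A d‖ ≤ κ * MB * ‖d‖ := by
    filter_upwards [htest, hB] with x hx hBx A hA d
    obtain ⟨K, hK, p, hp, -, hpn, hin⟩ := hx A hA (mulV A d)
    have h1 : ‖mulV A d‖ * ‖mulV A d‖ ≤ ‖mulV A d‖ * (κ * MB * ‖d‖) := by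
      rw [← real_inner_self_eq_norm_mul_norm, hin]
      calc -⟪mulV (hessYX ψ x (σ x)) d, p.fst⟫_ℝ
          ≤ ‖mulV (hessYX ψ x (σ x)) d‖ * ‖p.fst‖ :=
            (neg_le_abs _).trans (abs_real_inner_le_norm _ _)
        _ ≤ (MB * ‖d‖) * (κ * ‖mulV A d‖) := by
            refine mul_le_mul ((norm_mulV_le _ _).trans ?_) ((WithLp.norm_fst_le _ _).trans hpn)
              (norm_nonneg _) (by positivity)
            exact mul_le_mul_of_nonneg_right hBx (norm_nonneg _)
        _ = _ := by ring
    rcases (norm_nonneg (mulV A d)).eq_or_lt with h0 | h0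
    · rw [← h0]; positivity
    · exact le_of_mul_le_mul_left h1 h0
  refine ⟨?_, ⟨κ * MB, ?_⟩, ?_⟩
  · filter_upwards [hgp.eventually hne, hΩx] with x hx hxΩ
    obtain ⟨K, hK⟩ := hx (hSCD x hxΩ).1
    obtain ⟨Z, Y, rfl⟩ := exists_rge_of_mem_SCadj hK
    exact ⟨_, hxΩ, Z, Y, hK, rfl⟩
  · filter_upwards [hAd] with x hx A hA
    exact norm_le_of_mulV_le (by positivity) (hx A hA)
  · intro ε hε
    -- `M` bounds the displacement of the graph point: `1` for `dy`, the rest for `dz`. `C` is the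
    -- constant in `‖dx‖ + ‖dy‖ ≤ C ‖dx‖`.
    set M := 1 + (1 + MB + MH) with hM
    set C := 2 + 2 * (κ * MB) with hC
    have hMpos : 0 < M := by positivity
    have hCpos : 0 < C := by positivity
    -- The bound `1` serves the crude estimate of `dz`, the bound `1 / 2` lets `‖dy‖` be absorbed,
    -- and the last yields `ε`.
    obtain ⟨η, hη, hη1, hη2, hη3⟩ : ∃ η : ℝ, 0 < η ∧ η ≤ 1 ∧ κ * (η * (M + 1)) ≤ 1 / 2 ∧
        κ * (η * (M + 1)) * C ≤ ε := by
      refine ⟨min 1 (min (1 / (2 * (κ * (M + 1)))) (ε / (κ * (M + 1) * C))), by positivity,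
        min_le_left _ _, ?_, ?_⟩
      · have : min 1 (min (1 / (2 * (κ * (M + 1)))) (ε / (κ * (M + 1) * C))) ≤
            1 / (2 * (κ * (M + 1))) := (min_le_right _ _).trans (min_le_left _ _)
        rw [le_div_iff₀ (by positivity)] at this
        linarith
      · have : min 1 (min (1 / (2 * (κ * (M + 1)))) (ε / (κ * (M + 1) * C))) ≤
            ε / (κ * (M + 1) * C) := (min_le_right _ _).trans (min_le_right _ _)
        rw [le_div_iff₀ (by positivity)] at this
        linarith
    obtain ⟨δ, hδ, hss⟩ := hss η hη
    have hball := hgp.eventually (Metric.ball_mem_nhds _ hδ)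
    have hexp := (continuousAt_id.prodMk hσ : ContinuousAt (fun x => (x, σ x)) x₀).eventually
      (eventually_norm_sub_jacobian_le (contDiff_gradY hψ) x₀ (σ x₀) hη)
    refine eventually_nhdsWithin_of_eventually_nhds ?_
    filter_upwards [htest, hball, hexp, hΩx, hAd, hB, hH] with x ht hbx hex hxΩ hAx hBx hHx A hA
    set dx := x - x₀
    set dy := σ x - σ x₀
    set B := hessYX ψ x (σ x)
    set H := hessYY ψ x (σ x)
    set dz := -gradY ψ x (σ x) - -gradY ψ x₀ (σ x₀) with hdz
    have hex' : ‖-dz - (mulV B dx + mulV H dy)‖ ≤ η * (‖dx‖ + ‖dy‖) := by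
      have : -dz = gradY ψ x (σ x) - gradY ψ x₀ (σ x₀) := by rw [hdz]; abel
      rw [this]; exact hex
    have hdz' : ‖dz‖ ≤ (1 + MB + MH) * (‖dx‖ + ‖dy‖) := by
      have h1 : ‖mulV B dx‖ ≤ MB * ‖dx‖ :=
        (norm_mulV_le _ _).trans (mul_le_mul_of_nonneg_right hBx (norm_nonneg _))
      have h2 : ‖mulV H dy‖ ≤ MH * ‖dy‖ :=
        (norm_mulV_le _ _).trans (mul_le_mul_of_nonneg_right hHx (norm_nonneg _))
      have h3 : ‖dz‖ ≤ ‖-dz - (mulV B dx + mulV H dy)‖ + ‖mulV B dx + mulV H dy‖ := by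
        rw [← norm_neg dz]; exact norm_le_norm_sub_add _ _
      have h4 := norm_add_le (mulV B dx) (mulV H dy)
      have h5 : η * (‖dx‖ + ‖dy‖) ≤ 1 * (‖dx‖ + ‖dy‖) := by gcongr
      nlinarith [mul_nonneg hMB (norm_nonneg dy), mul_nonneg hMH (norm_nonneg dx)]
    have hnorm : ‖graphPoint ψ σ x - graphPoint ψ σ x₀‖ ≤ M * (‖dx‖ + ‖dy‖) := by
      have h1 : ‖graphPoint ψ σ x - graphPoint ψ σ x₀‖ ≤ ‖dy‖ + ‖dz‖ := by
        rw [WithLp.prod_norm_eq_of_L2]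
        refine Real.sqrt_le_iff.2 ⟨by positivity, ?_⟩
        change ‖dy‖ ^ 2 + ‖dz‖ ^ 2 ≤ _
        nlinarith [mul_nonneg (norm_nonneg dy) (norm_nonneg dz)]
      have := norm_nonneg dx
      rw [hM]; linarith
    obtain ⟨K, hK, p, hp, hpw, hpn, hin⟩ := ht A hA (dy - mulV A dx)
    -- Membership in the graph is part of semismoothness* at `x`, so Fermat's rule for the inner
    -- problem is not invoked.
    have hbnd := hss (σ x) (-gradY ψ x (σ x)) (hSCD x hxΩ).1 (by simpa [dist_eq_norm] using hbx)
      K hK p.fst p.snd hp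
    have hw : ‖dy - mulV A dx‖ ≤ κ * (η * (M * (‖dx‖ + ‖dy‖)) + η * (‖dx‖ + ‖dy‖)) := by
      refine norm_le_of_semismoothStar_bound (inner_hessYY_comm hψ x (σ x)) rfl (hin dx) hpw hpn
        (by positivity) hκ.le (hbnd.trans ?_) hex'
      exact mul_le_mul_of_nonneg_right (mul_le_mul_of_nonneg_left hnorm hη.le) (norm_nonneg p)
    have hw' : ‖dy - mulV A dx‖ ≤ κ * (η * (M + 1)) * (‖dx‖ + ‖dy‖) := by
      refine hw.trans (le_of_eq ?_); ring
    have hdy : ‖dx‖ + ‖dy‖ ≤ C * ‖dx‖ := by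
      have h1 : ‖dy‖ ≤ ‖dy - mulV A dx‖ + ‖mulV A dx‖ := norm_le_norm_sub_add _ _
      have h2 := hAx A hA dx
      have h3 : κ * (η * (M + 1)) * (‖dx‖ + ‖dy‖) ≤ 1 / 2 * (‖dx‖ + ‖dy‖) := by gcongr
      rw [hC]; linarith
    calc ‖dy - mulV A dx‖ ≤ κ * (η * (M + 1)) * (C * ‖dx‖) :=
          hw'.trans (mul_le_mul_of_nonneg_left hdy (by positivity))
      _ = κ * (η * (M + 1)) * C * ‖dx‖ := by ring
      _ ≤ ε * ‖dx‖ := by gcongr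

/-! ### Semismoothness of the gradient of the reduced function -/

/-- A chain rule: the error is the expansion error of `∇ₓψ` plus `∇²_{xy}ψ` applied to the error `dy
- A dx` of `σ`. -/
lemma semismoothAt_gradient_reducedReal (hψ : ContDiff ℝ 2 fun p : E n × E m => ψ p.1 p.2)
    (hΩ : IsOpen Ω)
    (hgrad : ∀ x ∈ Ω, HasGradientAt (reducedReal ψ q) (gradX ψ x (σ x)) x)
    {x₀ : E n} (hx₀ : x₀ ∈ Ω) (hσ : ContinuousAt σ x₀)
    (hΨ : SemismoothAt Ω σ (PsiMap ψ q Ω σ) x₀) :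
    SemismoothAt Ω (gradient (reducedReal ψ q)) (ThetaMap ψ q Ω σ) x₀ := by
  obtain ⟨hne, ⟨M, hM⟩, hss⟩ := hΨ
  have hΩx := hΩ.mem_nhds hx₀
  rw [hΩ.nhdsWithin_eq hx₀] at hss
  have hX := eventually_norm_le_of_continuous (continuous_jacobian_fst (contDiff_gradX hψ)) hσ
  have hY := eventually_norm_le_of_continuous (continuous_jacobian_snd (contDiff_gradX hψ)) hσ
  set MX := ‖jacobian (fun x' => gradX ψ x' (σ x₀)) x₀‖ + 1
  set MY := ‖jacobian (fun y' => gradX ψ x₀ y') (σ x₀)‖ + 1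
  have hMX : 0 ≤ MX := by positivity
  have hMY : 0 ≤ MY := by positivity
  refine ⟨?_, ⟨MX + MY * M, ?_⟩, ?_⟩
  · filter_upwards [hne, hΩx] with x ⟨A, hA⟩ hxΩ
    exact ⟨_, hxΩ, A, hA, rfl⟩
  · filter_upwards [hM, hX, hY] with x hMx hXx hYx
    rintro G ⟨-, A, hA, rfl⟩
    refine (norm_add_le _ _).trans (add_le_add hXx ?_)
    exact (Matrix.l2_opNorm_mul _ _).trans (mul_le_mul hYx (hMx A hA) (norm_nonneg _) hMY)
  · intro ε hε
    -- The absolute value appears because the bound `M` carries no sign.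
    set C := 1 + (1 + |M|) + MY with hC
    have hCpos : 0 < C := by positivity
    obtain ⟨η, hη, hη1, hη2⟩ : ∃ η : ℝ, 0 < η ∧ η ≤ 1 ∧ η * C ≤ ε := by
      refine ⟨min 1 (ε / C), by positivity, min_le_left _ _, ?_⟩
      rw [← le_div_iff₀ hCpos]; exact min_le_right _ _
    have hexp := (continuousAt_id.prodMk hσ : ContinuousAt (fun x => (x, σ x)) x₀).eventually
      (eventually_norm_sub_jacobian_le (contDiff_gradX hψ) x₀ (σ x₀) hη)
    rw [hΩ.nhdsWithin_eq hx₀]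
    filter_upwards [hss η hη, hexp, hM, hY, hΩx] with x hsx hex hMx hYx hxΩ
    rintro G ⟨-, A, hA, rfl⟩
    rw [(hgrad x hxΩ).gradient, (hgrad x₀ hx₀).gradient]
    set dx := x - x₀
    set dy := σ x - σ x₀
    set B := hessXX ψ x (σ x)
    set H := hessXY ψ x (σ x)
    have h1 := hsx A hA
    have h2 : ‖mulV H (dy - mulV A dx)‖ ≤ MY * (η * ‖dx‖) :=
      (norm_mulV_le _ _).trans (mul_le_mul hYx h1 (norm_nonneg _) hMY)
    have h3 : ‖dy‖ ≤ (1 + |M|) * ‖dx‖ := by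
      have h4 : ‖dy‖ ≤ ‖dy - mulV A dx‖ + ‖mulV A dx‖ := norm_le_norm_sub_add _ _
      have h5 : ‖mulV A dx‖ ≤ |M| * ‖dx‖ := (norm_mulV_le _ _).trans
        (mul_le_mul_of_nonneg_right ((hMx A hA).trans (le_abs_self M)) (norm_nonneg _))
      have h6 : η * ‖dx‖ ≤ 1 * ‖dx‖ := by gcongr
      have h7 : ‖dy - mulV A dx‖ ≤ η * ‖dx‖ := h1
      linarith
    have hex' : ‖gradX ψ x (σ x) - gradX ψ x₀ (σ x₀) - (mulV B dx + mulV H dy)‖ ≤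
        η * (‖dx‖ + ‖dy‖) := hex
    have h8 : gradX ψ x (σ x) - gradX ψ x₀ (σ x₀) - mulV (B + H * A) dx =
        (gradX ψ x (σ x) - gradX ψ x₀ (σ x₀) - (mulV B dx + mulV H dy)) +
          mulV H (dy - mulV A dx) := by
      have : mulV H (dy - mulV A dx) = mulV H dy - mulV H (mulV A dx) := map_sub _ _ _
      rw [mulV_add_left, mulV_mul, this]; abel
    rw [h8]
    calc _ ≤ η * (‖dx‖ + ‖dy‖) + MY * (η * ‖dx‖) := (norm_add_le _ _).trans (add_le_add hex' h2)
      _ ≤ η * (‖dx‖ + (1 + |M|) * ‖dx‖) + MY * (η * ‖dx‖) := by gcongr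
      _ = η * C * ‖dx‖ := by rw [hC]; ring
      _ ≤ ε * ‖dx‖ := by gcongr

end Reduced

/-! ### The semismooth Newton method -/

section Newton

variable {n : ℕ} {Θ : E n → Set (Matrix (Fin n) (Fin n) ℝ)} {x₀ : E n}

/-- By local boundedness, matrices taken along `x → x₀` accumulate at elements of `cl Θ (x₀)`; these
are nonsingular, and inversion is continuous there. -/
lemma eventually_isUnit_det_and_norm_inv_le (hbdd : ∃ M : ℝ, ∀ᶠ x in 𝓝 x₀, ∀ G ∈ Θ x, ‖G‖ ≤ M)
    (hreg : ∀ G ∈ clMap Θ x₀, IsUnit G.det) :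
    ∃ κ : ℝ, 0 < κ ∧ ∀ᶠ x in 𝓝 x₀, ∀ G ∈ Θ x, IsUnit G.det ∧ ‖G⁻¹‖ ≤ κ := by
  obtain ⟨M, hM⟩ := hbdd
  by_contra hcon
  push Not at hcon
  have key : ∀ k : ℕ, ∃ (x : E n) (G : Matrix (Fin n) (Fin n) ℝ),
      dist x x₀ < 1 / ((k : ℝ) + 1) ∧ G ∈ Θ x ∧ ‖G‖ ≤ M ∧
      -- The implication covers both failures at once, a singular `G` and a large inverse.
      (IsUnit G.det → (k : ℝ) + 1 < ‖G⁻¹‖) := by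
    intro k
    have hk : (0 : ℝ) < (k : ℝ) + 1 := by positivity
    obtain ⟨x, ⟨G, hG, hlt⟩, hx, hMx⟩ := ((hcon ((k : ℝ) + 1) hk).and_eventually
      ((Metric.eventually_nhds_iff_ball.2 ⟨_, one_div_pos.2 hk, fun _ h => h⟩).and hM)).exists
    exact ⟨x, G, hx, hG, hMx G hG, hlt⟩
  choose x G hx hG hGM hinv using key
  have hxlim : Tendsto x atTop (𝓝 x₀) :=
    tendsto_iff_dist_tendsto_zero.2 (squeeze_zero (fun _ => dist_nonneg) (fun k => (hx k).le)
      tendsto_one_div_add_atTop_nhds_zero_nat)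
  have : ProperSpace (Matrix (Fin n) (Fin n) ℝ) := FiniteDimensional.proper ℝ _
  obtain ⟨G₀, -, s, hs, hsG⟩ := (isCompact_closedBall (0 : Matrix (Fin n) (Fin n) ℝ) M).tendsto_subseq
    (x := G) (fun k => by rw [mem_closedBall_zero_iff]; exact hGM k)
  have hG₀ : IsUnit G₀.det := hreg _ <| mem_closure_of_tendsto
    ((hxlim.comp hs.tendsto_atTop).prodMk_nhds hsG) (Eventually.of_forall fun k => hG (s k))
  have hdet : Tendsto (fun k => (G (s k)).det) atTop (𝓝 G₀.det) :=
    ((continuous_id.matrix_det).tendsto G₀).comp hsG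
  have hunit : ∀ᶠ k in atTop, IsUnit (G (s k)).det :=
    (hdet.eventually_ne hG₀.ne_zero).mono fun _ h => isUnit_iff_ne_zero.2 h
  have hci : ContinuousAt Inv.inv G₀ := by
    refine continuousAt_matrix_inv G₀ ?_
    rw [Ring.inverse_eq_inv']
    exact continuousAt_inv₀ hG₀.ne_zero
  have hlim : Tendsto (fun k => ‖(G (s k))⁻¹‖) atTop (𝓝 ‖G₀⁻¹‖) := (hci.tendsto.comp hsG).norm
  have hlt := hlim.eventually_lt_const (lt_add_one _)
  have hbig : ∀ᶠ k : ℕ in atTop, ‖G₀⁻¹‖ + 1 ≤ (s k : ℝ) :=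
    (tendsto_natCast_atTop_atTop.comp hs.tendsto_atTop).eventually_ge_atTop _
  obtain ⟨k, h1, h2, h3⟩ := (hunit.and (hlt.and hbig)).exists
  linarith [hinv (s k) h1]

/-- Since `g x₀ = 0`, the new error is `-G⁻¹ (g x - g x₀ - G (x - x₀))`: a bounded inverse applied
to the semismoothness remainder. -/
lemma newtonSuperlinearAt_of_semismoothAt {Ω : Set (E n)} {g : E n → E n} (hΩ : Ω ∈ 𝓝 x₀)
    (hg : g x₀ = 0) (hss : SemismoothAt Ω g Θ x₀) (hreg : ∀ G ∈ clMap Θ x₀, IsUnit G.det) :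
    NewtonSuperlinearAt g Θ x₀ := by
  obtain ⟨hne, hbdd, ho⟩ := hss
  rw [nhdsWithin_eq_nhds.2 hΩ] at ho
  obtain ⟨κ, hκ, hinv⟩ := eventually_isUnit_det_and_norm_inv_le hbdd hreg
  have hstep : ∀ ε : ℝ, 0 < ε → ∀ᶠ x in 𝓝 x₀, ∀ G ∈ Θ x,
      ‖newtonStep g G x - x₀‖ ≤ ε * ‖x - x₀‖ := by
    intro ε hε
    filter_upwards [hinv, ho (ε / κ) (by positivity)] with x hx hox G hG
    obtain ⟨hu, hn⟩ := hx G hG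
    have h1 : newtonStep g G x - x₀ = -mulV G⁻¹ (g x - g x₀ - mulV G (x - x₀)) := by
      have : mulV G⁻¹ (g x - mulV G (x - x₀)) = mulV G⁻¹ (g x) - mulV G⁻¹ (mulV G (x - x₀)) :=
        map_sub _ _ _
      rw [hg, sub_zero, this, mulV_inv_cancel' hu, newtonStep]; abel
    rw [h1, norm_neg]
    calc _ ≤ κ * (ε / κ * ‖x - x₀‖) :=
          (norm_mulV_le _ _).trans (mul_le_mul hn (hox G hG) (norm_nonneg _) hκ.le)
      _ = ε * ‖x - x₀‖ := by field_simp
  -- With factor `1 / 2` the step maps a ball into itself and the iterates converge geometrically;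
  -- the `ε`-version then upgrades this to a superlinear rate.
  obtain ⟨r, hr, hball⟩ := Metric.eventually_nhds_iff_ball.1
    ((hstep (1 / 2) (by norm_num)).and (hinv.and hne))
  have hU : ∀ x ∈ Metric.ball x₀ r, ∀ G ∈ Θ x, newtonStep g G x ∈ Metric.ball x₀ r := by
    intro x hx G hG
    have h := (hball x hx).1 G hG
    rw [mem_ball_iff_norm] at hx ⊢
    linarith [norm_nonneg (x - x₀)]
  refine ⟨Metric.ball x₀ r, Metric.ball_mem_nhds _ hr, fun x hx => ⟨(hball x hx).2.2,
    fun G hG => ⟨((hball x hx).2.1 G hG).1, hU x hx G hG⟩⟩, ?_⟩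
  intro x G h0 hxG
  have hmem : ∀ k, x k ∈ Metric.ball x₀ r := by
    intro k
    induction k with
    | zero => exact h0
    | succ k ih => rw [(hxG k).2]; exact hU _ ih _ (hxG k).1
  have hgeom : ∀ k, ‖x k - x₀‖ ≤ (1 / 2 : ℝ) ^ k * ‖x 0 - x₀‖ := by
    intro k
    induction k with
    | zero => simp
    | succ k ih =>
      have h := (hball _ (hmem k)).1 _ (hxG k).1
      rw [← (hxG k).2] at h
      rw [pow_succ]
      linarith
  have hlim : Tendsto x atTop (𝓝 x₀) := by
    rw [tendsto_iff_norm_sub_tendsto_zero]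
    refine squeeze_zero (fun _ => norm_nonneg _) hgeom ?_
    simpa using (tendsto_pow_atTop_nhds_zero_of_lt_one (r := (1 / 2 : ℝ)) (by norm_num)
      (by norm_num)).mul_const ‖x 0 - x₀‖
  refine ⟨hlim, isLittleO_iff.2 fun ε hε => ?_⟩
  filter_upwards [hlim.eventually (hstep ε hε)] with k hk
  rw [norm_norm, norm_norm, (hxG k).2]
  exact hk _ (hxG k).1

end Newton

/-- Fermat's rule for the reduced function at a global minimizer. -/
lemma gradient_reducedReal_eq_zero {n m : ℕ} {ψ : E n → E m → ℝ} {q : E m → EReal}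
    {Ω : Set (E n)} {x₀ v : E n} (hΩ : Ω ∈ 𝓝 x₀)
    (hfin : ∀ x ∈ Ω, reduced ψ q x ≠ ⊤ ∧ reduced ψ q x ≠ ⊥)
    (hgrad : HasGradientAt (reducedReal ψ q) v x₀)
    (hmin : ∀ x, reduced ψ q x₀ ≤ reduced ψ q x) : gradient (reducedReal ψ q) x₀ = 0 := by
  have hloc : IsLocalMin (reducedReal ψ q) x₀ := by
    filter_upwards [hΩ] with x hx
    exact EReal.toReal_le_toReal (hmin x) (hfin x₀ (mem_of_mem_nhds hΩ)).2 (hfin x hx).1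
  have := hloc.hasFDerivAt_eq_zero hgrad.hasFDerivAt
  rw [hgrad.gradient]
  exact (map_eq_zero_iff _ (InnerProductSpace.toDual ℝ (E n)).injective).1 this

end SCDNewton

end

theorem mainTheorem3 {n m : ℕ} (ψ : E n → E m → ℝ) (q : E m → EReal)
    (Ω : Set (E n)) (σ : E n → E m)
    (hψ : ContDiff ℝ 2 (fun p : E n × E m => ψ p.1 p.2))
    (hq_lsc : LowerSemicontinuous q)
    (hq_bot : ∀ y, q y ≠ ⊥) (hq_dom : ∃ y, q y ≠ ⊤)
    (hΩ : IsOpen Ω)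
    (hσ : ∀ x ∈ Ω, {y | ∀ y', objective ψ q x y ≤ objective ψ q x y'} = {σ x})
    (hσ_bdd : ∀ x₀ ∈ Ω, ∃ U ∈ 𝓝 x₀, Bornology.IsBounded (σ '' (U ∩ Ω)))
    (hSCD : ∀ x ∈ Ω, SCDSemismoothStarAt (limSubdiff q) (σ x) (-gradY ψ x (σ x)))
    (hreg : ∀ x ∈ Ω, ∀ Z Y : Matrix (Fin m) (Fin m) ℝ,
      rge Z Y ∈ SCadj (limSubdiff q) (pair (σ x) (-gradY ψ x (σ x))) →
        IsUnit (hessYY ψ x (σ x) * Z + Y).det) :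
    SemismoothOn Ω σ (PsiMap ψ q Ω σ) ∧
    (∀ x ∈ Ω, reduced ψ q x ≠ ⊤ ∧ reduced ψ q x ≠ ⊥ ∧
      HasGradientAt (reducedReal ψ q) (gradX ψ x (σ x)) x) ∧
    SemismoothOn Ω (gradient (reducedReal ψ q)) (ThetaMap ψ q Ω σ) ∧
    (∀ x₀ ∈ Ω, (∀ x, reduced ψ q x₀ ≤ reduced ψ q x) →
      (∀ G ∈ clMap (ThetaMap ψ q Ω σ) x₀, IsUnit G.det) →
      NewtonSuperlinearAt (gradient (reducedReal ψ q)) (ThetaMap ψ q Ω σ) x₀) := by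
  have hmin : ∀ x ∈ Ω, ∀ y', objective ψ q x (σ x) ≤ objective ψ q x y' := fun x hx => by
    have : σ x ∈ {y | ∀ y', objective ψ q x y ≤ objective ψ q x y'} := by rw [hσ x hx]; rfl
    exact this
  have hcont : ∀ x ∈ Ω, ContinuousAt σ x := fun x hx =>
    continuousAt_argmin hψ.continuous hq_lsc hq_bot hq_dom hΩ hσ hx (hσ_bdd x hx)
  have hgrad : ∀ x ∈ Ω, HasGradientAt (reducedReal ψ q) (gradX ψ x (σ x)) x := fun x hx =>
    hasGradientAt_reducedReal hψ hq_bot hq_dom hΩ hmin hx (hcont x hx)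
  have hfin : ∀ x ∈ Ω, reduced ψ q x ≠ ⊤ ∧ reduced ψ q x ≠ ⊥ := fun x hx => by
    rw [reduced_eq_coe hq_bot (ne_top_of_isMin hq_dom (hmin x hx)) (hmin x hx)]
    exact ⟨EReal.coe_ne_top _, EReal.coe_ne_bot _⟩
  have hΨ : SemismoothOn Ω σ (PsiMap ψ q Ω σ) := fun x hx =>
    semismoothAt_argmin hψ hΩ hSCD hreg hx (hcont x hx)
  have hΘ : SemismoothOn Ω (gradient (reducedReal ψ q)) (ThetaMap ψ q Ω σ) := fun x hx =>
    semismoothAt_gradient_reducedReal hψ hΩ hgrad hx (hcont x hx) (hΨ x hx)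
  refine ⟨hΨ, fun x hx => ⟨(hfin x hx).1, (hfin x hx).2, hgrad x hx⟩, hΘ, ?_⟩
  intro x₀ hx₀ hglob hns
  have hΩx := hΩ.mem_nhds hx₀
  exact newtonSuperlinearAt_of_semismoothAt hΩx
    (gradient_reducedReal_eq_zero hΩx hfin (hgrad x₀ hx₀) hglob) (hΘ x₀ hx₀) hns
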